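/- Fix a finite set $\tau$ of tiles together with horizontal and vertical constraints: a set of ordered pairs of tiles allowed on horizontally adjacent cells of $\mathbb Z^2$ and a set of ordered pairs allowed on vertically adjacent cells. A tiling of $\mathbb Z^2$, or of an $n\times n$ square, by $\tau$ is valid if it respects these constraints; $\tau$ tiles the plane if $\mathbb Z^2$ has a valid tiling. Let $\mathcal L=\{U,D,0\}$, $\mathcal S=\{\downarrow,\uparrow,\leftarrow,\rightarrow,\swarrow,\searrow,\nwarrow,\nearrow\}\cup\tau$ and $\mathcal A=\mathcal L\cup\mathcal S$. In all patterns north is up. A $3\times3$ pattern over $\mathcal A$ is *allowed* if any two horizontally or vertically adjacent tiles in it satisfy the constraints of $\tau$ and if it can be obtained from a $3\times 3$ block of consecutive rows and columns of the table $$\begin{matrix} \mathcal L&\mathcal L&\mathcal L&\mathcal L&\mathcal L&\mathcal L&\mathcal L&\mathcal L&\mathcal L&\mathcal L\\ \mathcal L&\mathcal L&\mathcal L&\mathcal L&\mathcal L&\mathcal L&\mathcal L&\mathcal L&\mathcal L&\mathcal L\\ \mathcal L&\mathcal L&\mathcal L&\searrow&\downarrow&\downarrow&\downarrow&\swarrow&\mathcal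 L&\mathcal L\\ \mathcal L&\mathcal L&\mathcal L&\rightarrow&\tau&\tau&\tau&\leftarrow&\mathcal L&\mathcal L\\ \mathcal L&\mathcal L&\mathcal L&\rightarrow&\tau&\tau&\tau&\leftarrow&\mathcal L&\mathcal L\\ \mathcal L&\mathcal L&\mathcal L&\rightarrow&\tau&\tau&\tau&\leftarrow&\mathcal L&\mathcal L\\ \mathcal L&\mathcal L&\mathcal L&\nearrow&\uparrow&\uparrow&\uparrow&\nwarrow&\mathcal L&\mathcal L\\ \mathcal L&\mathcal L&\mathcal L&\mathcal L&\mathcal L&\mathcal L&\mathcal L&\mathcal L&\mathcal L&\mathcal L\\ \mathcal L&\mathcal L&\mathcal L&\mathcal L&\mathcal L&\mathcal L&\mathcal L&\mathcal L&\mathcal L&\mathcal L \end{matrix}$$ by replacing each $\mathcal L$ by an element of $\mathcal L$ and each $\tau$ by a tile of $\tau$. Let $F_\tau:\mathcal A^{\mathbb Z^2}\to\mathcal A^{\mathbb Z^2}$ be the two-dimensional cellular automaton whose local rule, applied to the $5\times 5$ neighbourhood of a cell, is as follows. (1) If one of the nine $3\times3$ sub-patterns of the neighbourhood is not allowed, the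 new state is $0$. (2) Otherwise the central $3\times 3$ pattern of the neighbourhood is considered (its rows are written from north to south and separated by slashes; $Q=\{0\}\cup\mathcal S$; a set stands for any of its elements). * The state is kept if the pattern is $\mathcal S\mathcal S\mathcal S/\mathcal S\mathcal S\mathcal S/\mathcal S\mathcal S\mathcal S$ or a rotation by a multiple of $\pi/2$ of $\mathcal L\mathcal L\mathcal L/\mathcal S\mathcal S\mathcal L/\mathcal S\mathcal S\mathcal L$ or of $\mathcal S\mathcal S\mathcal L/\mathcal S\mathcal S\mathcal L/\mathcal S\mathcal S\mathcal L$. * The new state is $U$ if the pattern is one of $Q00/\mathcal S00/\mathcal SU0$, $\ 000/000/\mathcal SU0$, $\ 000/00U/\mathcal S\mathcal S(Q\cup\{D\})$, $\ 000/00U/0Q\mathcal S$, $\ 0UQ/00\mathcal S/00\mathcal S$, $\ 0U\mathcal S/00\mathcal S/00D$, $\ QQQ/Q0U/QQD$. * The new state is $D$ if the pattern is one of $\mathcal SD0/\mathcal S00/Q00$, $\ \mathcal SD0/000/000$, $\ \mathcal S\mathcal S(Q\cup\{U\})/00D/000$, $\ 0Q\mathcal S/00D/000$, $\ 00\mathcal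 S/00\mathcal S/0DQ$, $\ 00U/00\mathcal S/0D\mathcal S$, $\ QQU/Q0D/QQQ$. (3) In all other cases the new state is $0$. Equip $\mathcal A^{\mathbb Z^2}$ with the metric $d(x,y)=2^{-\min\{\|z\|_\infty:\,x(z)\neq y(z)\}}$ for $x\ne y$. A point $x$ is an equicontinuous point of $F$ if for all $\epsilon>0$ there is $\delta>0$ such that $d(x,y)<\delta$ implies $d(F^t(x),F^t(y))<\epsilon$ for all $t\ge 0$. A number $\epsilon>0$ is a sensitivity constant of $F$ if for all $\delta>0$ and all $x$ there are $y$ and $t\ge0$ with $d(x,y)<\delta$ and $d(F^t(x),F^t(y))>\epsilon$; $F$ is sensitive if it has a sensitivity constant. **Proposition.** There is a function $g:\mathbb N\to\mathbb R$, with constants $c,C>0$ such that $c\,2^{-n/2}\le g(n)\le C\,2^{-n/2}$ for all $n\ge 0$, such that for every finite tile set $\tau$: * $F_\tau$ has no equicontinuous point; * $F_\tau$ is sensitive if and only if $\tau$ does not tile the plane; * if $F_\tau$ is sensitive, then there is a largest $n\ge 0$ such that an $n\times n$ square has a valid tiling by $\tau$, and the supremum of the sensitivity constants of $F_\tau$ is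 exactly $g(n)$. -/

import Mathlib

universe u

namespace TileCA

/-! ### Two-dimensional configurations and their metric -/

/-- Configurations on the square lattice. A cell is `(x, y)`, with `x` growing to the east
and `y` growing to the north. -/
def Config (A : Type u) : Type u := ℤ × ℤ → A

/-- The sup norm on the lattice, as a natural number. -/
def supNorm (z : ℤ × ℤ) : ℕ := max z.1.natAbs z.2.natAbs

open Classical in
/-- `2 ^ (- min {‖z‖ : x z ≠ y z})`, and `0` if `x = y`. -/
noncomputable def configDist {A : Type u} (x y : Config A) : ℝ :=
  if x = y then 0 else (1 / 2 : ℝ) ^ sInf {k : ℕ | ∃ z, supNorm z = k ∧ x z ≠ y z}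

theorem configDist_le_iff {A : Type u} (x y : Config A) (k : ℕ) :
    configDist x y ≤ (1 / 2 : ℝ) ^ k ↔ ∀ z, supNorm z < k → x z = y z := by
  unfold configDist
  split_ifs with h
  · subst h
    simp
  · rw [pow_le_pow_iff_right_of_lt_one₀ (by norm_num) (by norm_num)]
    constructor
    · intro hk z hz
      by_contra hne
      exact absurd (Nat.sInf_le (s := {k : ℕ | ∃ z, supNorm z = k ∧ x z ≠ y z}) ⟨z, rfl, hne⟩)
        (by omega)
    · intro hk
      have hne : {k : ℕ | ∃ z, supNorm z = k ∧ x z ≠ y z}.Nonempty := by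
        obtain ⟨z, hz⟩ := Function.ne_iff.mp h
        exact ⟨_, z, rfl, hz⟩
      obtain ⟨z, hz, hxy⟩ := Nat.sInf_mem hne
      by_contra hlt
      exact hxy (hk z (by omega))

theorem configDist_nonneg {A : Type u} (x y : Config A) : 0 ≤ configDist x y := by
  unfold configDist
  split_ifs <;> positivity

theorem configDist_eq_zero {A : Type u} {x y : Config A} (h : configDist x y = 0) : x = y := by
  by_contra hne
  simp [configDist, hne] at h

theorem configDist_comm {A : Type u} (x y : Config A) : configDist x y = configDist y x := by
  by_cases h : x = y
  · rw [h]
  · simp only [configDist, if_neg h, if_neg (Ne.symm h), ne_comm]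

theorem configDist_triangle {A : Type u} (x y z : Config A) :
    configDist x z ≤ configDist x y + configDist y z := by
  have hx := configDist_nonneg x y
  have hz := configDist_nonneg y z
  by_cases hxy : x = y
  · subst hxy; linarith
  by_cases hyz : y = z
  · subst hyz; linarith
  obtain ⟨a, ha⟩ : ∃ a : ℕ, configDist x y = (1 / 2 : ℝ) ^ a := ⟨_, by rw [configDist, if_neg hxy]⟩
  obtain ⟨b, hb⟩ : ∃ b : ℕ, configDist y z = (1 / 2 : ℝ) ^ b := ⟨_, by rw [configDist, if_neg hyz]⟩
  have h1 := (configDist_le_iff x y a).1 ha.le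
  have h2 := (configDist_le_iff y z b).1 hb.le
  rcases le_total a b with hab | hab
  · have := (configDist_le_iff x z a).2 fun w hw => (h1 w hw).trans (h2 w (by omega))
    linarith
  · have := (configDist_le_iff x z b).2 fun w hw => (h1 w (by omega)).trans (h2 w hw)
    linarith

noncomputable instance {A : Type u} : MetricSpace (Config A) where
  dist := configDist
  dist_self x := by simp [configDist]
  dist_comm := configDist_comm
  dist_triangle := configDist_triangle
  eq_of_dist_eq_zero := configDist_eq_zero

/-! ### Topological dynamics -/

/-- `x` is an equicontinuous point of `F`. -/
def IsEquicontinuousPoint {X : Type u} [MetricSpace X] (F : X → X) (x : X) : Prop :=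
  ∀ ε > 0, ∃ δ > 0, ∀ y, dist x y < δ → ∀ n : ℕ, dist (F^[n] x) (F^[n] y) < ε

/-- `ε` is an admissible sensitivity constant of `F`. -/
def IsSensitivityConstant {X : Type u} [MetricSpace X] (F : X → X) (ε : ℝ) : Prop :=
  0 < ε ∧ ∀ δ > 0, ∀ x, ∃ y, ∃ n : ℕ, dist x y < δ ∧ ε < dist (F^[n] x) (F^[n] y)

/-- `F` is sensitive to initial conditions. -/
def IsSensitive {X : Type u} [MetricSpace X] (F : X → X) : Prop :=
  ∃ ε, IsSensitivityConstant F ε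

/-! ### Tile sets -/

/-- A tile set with tiles `T`: `hor a b` says that `b` may stand immediately to the east of `a`,
and `ver a b` that `b` may stand immediately to the north of `a`. -/
structure TileSet (T : Type u) where
  hor : T → T → Prop
  ver : T → T → Prop

/-- The tile set tiles the plane. -/
def TileSet.TilesPlane {T : Type u} (τ : TileSet T) : Prop :=
  ∃ t : ℤ × ℤ → T, ∀ x y : ℤ,
    τ.hor (t (x, y)) (t (x + 1, y)) ∧ τ.ver (t (x, y)) (t (x, y + 1))

/-- There is a valid tiling of an `n × n` square. -/
def TileSet.TilesSquare {T : Type u} (τ : TileSet T) (n : ℕ) : Prop :=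
  ∃ t : Fin n → Fin n → T,
    (∀ i i' j : Fin n, (i' : ℕ) = i + 1 → τ.hor (t i j) (t i' j)) ∧
    (∀ i j j' : Fin n, (j' : ℕ) = j + 1 → τ.ver (t i j) (t i j'))

/-! ### States and patterns -/

/-- The states: the liquid ones `U`, `D`, `O` (where `O` is the state `0`), the eight arrows, named
by the direction in which they point, and the tiles. -/
inductive State (T : Type u) : Type u
  | U | D | O
  | north | south | east | west | northeast | northwest | southeast | southwest
  | tile (t : T)

/-- The liquid component `{U, D, 0}`. -/
def liquid (T : Type u) : Set (State T) := {State.U, State.D, State.O}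

/-- The solid component: the arrows and the tiles. -/
def solid (T : Type u) : Set (State T) := (liquid T)ᶜ

/-- The set of all tiles. -/
def tiles (T : Type u) : Set (State T) := Set.range State.tile

/-- The pattern `P` matches the table `M` of permitted states. In all patterns and tables the first
index is the row, counted from north to south, and the second index is the column, counted from
west to east. -/
def Matches {T : Type u} {m n : ℕ} (P : Matrix (Fin m) (Fin n) (State T))
    (M : Matrix (Fin m) (Fin n) (Set (State T))) : Prop :=
  ∀ i j, P i j ∈ M i j

/-- The `3 × 3` sub-pattern with north-west cell `(r, c)`. -/
def block {B : Type u} {m n : ℕ} (P : Matrix (Fin (m + 2)) (Fin (n + 2)) B) (r : Fin m)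
    (c : Fin n) : Matrix (Fin 3) (Fin 3) B :=
  fun i j => P ⟨r + i, by omega⟩ ⟨c + j, by omega⟩

/-- The picture of an obstacle with liquid around it. -/
def obstaclePicture (T : Type u) : Matrix (Fin 9) (Fin 10) (Set (State T)) :=
  let l := liquid T
  let t := tiles T
  let n : Set (State T) := {State.north}
  let s : Set (State T) := {State.south}
  let e : Set (State T) := {State.east}
  let w : Set (State T) := {State.west}
  let ne : Set (State T) := {State.northeast}
  let nw : Set (State T) := {State.northwest}
  let se : Set (State T) := {State.southeast}
  let sw : Set (State T) := {State.southwest}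
  !![l, l, l, l,  l, l, l, l,  l, l;
     l, l, l, l,  l, l, l, l,  l, l;
     l, l, l, se, s, s, s, sw, l, l;
     l, l, l, e,  t, t, t, w,  l, l;
     l, l, l, e,  t, t, t, w,  l, l;
     l, l, l, e,  t, t, t, w,  l, l;
     l, l, l, ne, n, n, n, nw, l, l;
     l, l, l, l,  l, l, l, l,  l, l;
     l, l, l, l,  l, l, l, l,  l, l]

/-- Adjacent tiles of the pattern satisfy the constraints of `τ`. -/
def RespectsTiling {T : Type u} (τ : TileSet T) (P : Matrix (Fin 3) (Fin 3) (State T)) : Prop :=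
  (∀ i j j' : Fin 3, (j' : ℕ) = j + 1 → ∀ a b, P i j = .tile a → P i j' = .tile b → τ.hor a b) ∧
  (∀ i i' j : Fin 3, (i' : ℕ) = i + 1 → ∀ a b, P i j = .tile a → P i' j = .tile b → τ.ver b a)

/-- The allowed `3 × 3` patterns of the subshift of admissible obstacles: those that appear in the
picture and respect the tiling constraints. -/
def Allowed {T : Type u} (τ : TileSet T) (P : Matrix (Fin 3) (Fin 3) (State T)) : Prop :=
  (∃ (r : Fin 7) (c : Fin 8), Matches P (block (obstaclePicture T) r c)) ∧ RespectsTiling τ P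

/-- A `5 × 5` pattern is forbidden if one of its `3 × 3` sub-patterns is not allowed. -/
def Forbidden {T : Type u} (τ : TileSet T) (P : Matrix (Fin 5) (Fin 5) (State T)) : Prop :=
  ∃ r c : Fin 3, ¬ Allowed τ (block P r c)

/-! ### The transition tables -/

/-- A table turned by a quarter turn. -/
def rotate {B : Type u} (M : Matrix (Fin 3) (Fin 3) B) : Matrix (Fin 3) (Fin 3) B :=
  fun i j => M j i.rev

/-- Neighbourhoods in which a solid cell keeps its state: corners and sides of an obstacle,
up to rotation, and solid interiors. -/
def keepTables (T : Type u) : Set (Matrix (Fin 3) (Fin 3) (Set (State T))) :=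
  let l := liquid T
  let s := solid T
  let corner := !![l, l, l; s, s, l; s, s, l]
  let side := !![s, s, l; s, s, l; s, s, l]
  let interior := !![s, s, s; s, s, s; s, s, s]
  {M | (∃ k : Fin 4, M = rotate^[k] corner ∨ M = rotate^[k] side) ∨ M = interior}

/-- Neighbourhoods in which a cell becomes `U`. -/
def upTables (T : Type u) : Set (Matrix (Fin 3) (Fin 3) (Set (State T))) :=
  let s := solid T
  let o : Set (State T) := {State.O}
  let U : Set (State T) := {State.U}
  let D : Set (State T) := {State.D}
  let q := o ∪ s
  {!![q, o, o; s, o, o; s, U, o],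
   !![o, o, o; o, o, o; s, U, o],
   !![o, o, o; o, o, U; s, s, q ∪ D],
   !![o, o, o; o, o, U; o, q, s],
   !![o, U, q; o, o, s; o, o, s],
   !![o, U, s; o, o, s; o, o, D],
   !![q, q, q; q, o, U; q, q, D]}

/-- Neighbourhoods in which a cell becomes `D`. -/
def downTables (T : Type u) : Set (Matrix (Fin 3) (Fin 3) (Set (State T))) :=
  let s := solid T
  let o : Set (State T) := {State.O}
  let U : Set (State T) := {State.U}
  let D : Set (State T) := {State.D}
  let q := o ∪ s
  {!![s, D, o; s, o, o; q, o, o],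
   !![s, D, o; o, o, o; o, o, o],
   !![s, s, q ∪ U; o, o, D; o, o, o],
   !![o, q, s; o, o, D; o, o, o],
   !![o, o, s; o, o, s; o, D, q],
   !![o, o, U; o, o, s; o, D, s],
   !![q, q, U; q, o, D; q, q, q]}

open Classical in
/-- The local rule. The conditions of the last three nontrivial cases exclude one another. -/
noncomputable def localRule {T : Type u} (τ : TileSet T) (P : Matrix (Fin 5) (Fin 5) (State T)) :
    State T :=
  if Forbidden τ P then .O
  else if ∃ M ∈ keepTables T, Matches (block P 1 1) M then P 2 2
  else if ∃ M ∈ upTables T, Matches (block P 1 1) M then .U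
  else if ∃ M ∈ downTables T, Matches (block P 1 1) M then .D
  else .O

/-- The `5 × 5` pattern of `x` around the cell `z`. -/
def neighbourhood {A : Type u} (x : Config A) (z : ℤ × ℤ) : Matrix (Fin 5) (Fin 5) A :=
  fun i j => x (z.1 + ((j : ℕ) : ℤ) - 2, z.2 + 2 - ((i : ℕ) : ℤ))

/-- The two-dimensional cellular automaton `F_τ`, of radius `2`. -/
noncomputable def tileCA {T : Type u} (τ : TileSet T) (x : Config (State T)) : Config (State T) :=
  fun z => localRule τ (neighbourhood x z)

end TileCA

/-! A solid cell survives only while all nine patterns around it are allowed, and solid cells are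
never created. In an admissible configuration with finitely many solid cells these form obstacles:
rectangles with a frame of arrows, validly tiled inside, each with a ring of liquid two cells wide
(`Admissible.exists_isObstacle`). A `U` directly above a `D` travels west as a pair. At an obstacle
the two separate, `U` passing over the north side and `D` under the south side, and they reunite on
the west side with the height of impact reflected (`iterate_pairAt_of_isObstacle`).

Instability comes from such pairs. Cut a point `x` down to a large ball and put `O` elsewhere. The
solid cells that survive forever make up an admissible `limitConfig`. All particles drift west, so
every half plane to the east eventually agrees with this limit (`exists_eq_limitConfig`). Tracing a
pair backwards to the east shows that every liquid cell of the limit is hit by a pair launched from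
far away (`exists_iterate_pairAt`, `exists_iterate_ne`). Hence a change of `x` outside the ball is
eventually seen in that cell. For every `x` some fixed cell is liquid in the limits of all large
cuts, so no point is equicontinuous.

How near to the origin a liquid cell must occur depends on the tilings. An obstacle that covers the
ball of radius `k ≥ 1` contains a tiled square of side `2 * k - 1`, so a bound `n` on tileable
squares forces a liquid cell within distance `sensitivityExponent n`. Conversely, a tiled `n × n`
square with `n ≥ 2`, framed by arrows and placed around the origin, is stable and shields all
smaller distances (`IsSensitivityConstant.lt`). The framed interior always has side at least 2,
which is why the exponent is `0` for `n < 2`. Compactness turns the absence of a tiling of the plane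
into such a bound `n`. -/

namespace TileCA

/-! ### Kinds of states -/

/-- Position of a solid state in an obstacle: its row class and its column class, where `1`, `2`,
`3` stand for the first, a middle and the last row or column. Liquid states have kind `(0, 0)`. -/
def kind {T : Type u} : State T → Fin 4 × Fin 4
  | .U | .D | .O => (0, 0)
  | .southeast => (1, 1)
  | .south => (1, 2)
  | .southwest => (1, 3)
  | .east => (2, 1)
  | .tile _ => (2, 2)
  | .west => (2, 3)
  | .northeast => (3, 1)
  | .north => (3, 2)
  | .northwest => (3, 3)

/-- The kind in a given row class and column class. -/
def kindOf (a b : Fin 4) : Fin 4 × Fin 4 := if a = 0 ∨ b = 0 then (0, 0) else (a, b)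

def rowClass : Fin 9 → Fin 4 := ![0, 0, 1, 2, 2, 2, 3, 0, 0]

def colClass : Fin 10 → Fin 4 := ![0, 0, 0, 1, 2, 2, 2, 3, 0, 0]

/-- The kinds in the `3 × 3` block of the picture with north-west cell `(r, c)`. -/
def blockKind (r : Fin 7) (c : Fin 8) (i j : Fin 3) : Fin 4 × Fin 4 :=
  kindOf (rowClass ⟨r + i, by omega⟩) (colClass ⟨c + j, by omega⟩)

variable {T : Type u}

theorem mem_liquid_iff {a : State T} : a ∈ liquid T ↔ kind a = (0, 0) := by
  cases a <;> simp [liquid, kind]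

theorem mem_solid_iff {a : State T} : a ∈ solid T ↔ kind a ≠ (0, 0) := by
  rw [solid, Set.mem_compl_iff, mem_liquid_iff]

theorem notMem_solid_iff {a : State T} : a ∉ solid T ↔ a ∈ liquid T := by
  simp [solid]

@[simp] theorem kind_U : kind (State.U : State T) = (0, 0) := rfl
@[simp] theorem kind_D : kind (State.D : State T) = (0, 0) := rfl
@[simp] theorem kind_O : kind (State.O : State T) = (0, 0) := rfl

/-- Each set in the picture is a fibre of `kind`, and the picture is a product of row and column
classes. This makes allowed patterns finite data, free of the tile set, so that statements about
them can be settled by `decide`. -/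
theorem mem_obstaclePicture_iff (a : Fin 9) (b : Fin 10) (s : State T) :
    s ∈ obstaclePicture T a b ↔ kind s = kindOf (rowClass a) (colClass b) := by
  have ht : s ∈ tiles T ↔ kind s = (2, 2) := by cases s <;> simp [tiles, kind]
  have h1 : s = .southeast ↔ kind s = (1, 1) := by cases s <;> simp [kind]
  have h2 : s = .south ↔ kind s = (1, 2) := by cases s <;> simp [kind]
  have h3 : s = .southwest ↔ kind s = (1, 3) := by cases s <;> simp [kind]
  have h4 : s = .east ↔ kind s = (2, 1) := by cases s <;> simp [kind]
  have h5 : s = .west ↔ kind s = (2, 3) := by cases s <;> simp [kind]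
  have h6 : s = .northeast ↔ kind s = (3, 1) := by cases s <;> simp [kind]
  have h7 : s = .north ↔ kind s = (3, 2) := by cases s <;> simp [kind]
  have h8 : s = .northwest ↔ kind s = (3, 3) := by cases s <;> simp [kind]
  fin_cases a <;> fin_cases b <;>
    first
    | exact mem_liquid_iff
    | exact ht
    | exact h1
    | exact h2
    | exact h3
    | exact h4
    | exact h5
    | exact h6
    | exact h7
    | exact h8

theorem allowed_iff {τ : TileSet T} {P : Matrix (Fin 3) (Fin 3) (State T)} :
    Allowed τ P ↔
      (∃ r c, ∀ i j, kind (P i j) = blockKind r c i j) ∧ RespectsTiling τ P := by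
  simp only [Allowed, Matches, block, mem_obstaclePicture_iff, blockKind]

/-! ### Solid cells are kept -/

/-- Rotation commutes with entrywise maps, so the rotated tables of sets can be replaced by rotated
Boolean masks. -/
theorem iterate_rotate_map {A B : Type*} (f : A → B) (M : Matrix (Fin 3) (Fin 3) A) (k : ℕ) :
    rotate^[k] (fun i j => f (M i j)) = fun i j => f (rotate^[k] M i j) := by
  induction k generalizing M with
  | zero => rfl
  | succ k ih => exact ih (rotate M)

def cornerMask : Matrix (Fin 3) (Fin 3) Bool :=
  !![false, false, false; true, true, false; true, true, false]

def sideMask : Matrix (Fin 3) (Fin 3) Bool :=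
  !![true, true, false; true, true, false; true, true, false]

/-- The mask `cornerMask`, turned by `k` quarter turns. -/
def cornerTurn (k : Fin 4) (i j : Fin 3) : Bool := rotate^[k] cornerMask i j

/-- The mask `sideMask`, turned by `k` quarter turns. -/
def sideTurn (k : Fin 4) (i j : Fin 3) : Bool := rotate^[k] sideMask i j

/-- The liquid or the solid states. -/
def maskSet (T : Type u) (b : Bool) : Set (State T) := if b then solid T else liquid T

theorem mem_maskSet {s : State T} {b : Bool} :
    s ∈ maskSet T b ↔ decide (kind s ≠ (0, 0)) = b := by
  cases b <;> simp [maskSet, mem_liquid_iff, mem_solid_iff]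

theorem mem_keepTables_iff {M : Matrix (Fin 3) (Fin 3) (Set (State T))} :
    M ∈ keepTables T ↔
      (∃ k : Fin 4, M = (fun i j => maskSet T (cornerTurn k i j)) ∨
        M = fun i j => maskSet T (sideTurn k i j)) ∨ M = fun _ _ => maskSet T true := by
  have h1 : (!![liquid T, liquid T, liquid T; solid T, solid T, liquid T;
      solid T, solid T, liquid T] : Matrix (Fin 3) (Fin 3) _) =
      fun i j => maskSet T (cornerMask i j) := by
    ext i j : 2
    fin_cases i <;> fin_cases j <;> rfl
  have h2 : (!![solid T, solid T, liquid T; solid T, solid T, liquid T;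
      solid T, solid T, liquid T] : Matrix (Fin 3) (Fin 3) _) =
      fun i j => maskSet T (sideMask i j) := by
    ext i j : 2
    fin_cases i <;> fin_cases j <;> rfl
  have h3 : (!![solid T, solid T, solid T; solid T, solid T, solid T;
      solid T, solid T, solid T] : Matrix (Fin 3) (Fin 3) _) = fun _ _ => maskSet T true := by
    ext i j : 2
    fin_cases i <;> fin_cases j <;> rfl
  simp only [keepTables, Set.mem_ofPred_eq, h1, h2, h3]
  simp only [iterate_rotate_map]
  rfl

theorem solid_of_matches_keepTables {P M : Matrix (Fin 3) (Fin 3) _} (hM : M ∈ keepTables T)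
    (h : Matches P M) : P 1 1 ∈ solid T := by
  have key : ∀ k : Fin 4, cornerTurn k 1 1 = true ∧ sideTurn k 1 1 = true := by
    decide
  have h11 := h 1 1
  rcases mem_keepTables_iff.1 hM with ⟨k, rfl | rfl⟩ | rfl
  · simpa [maskSet, (key k).1] using h11
  · simpa [maskSet, (key k).2] using h11
  · exact h11

set_option maxRecDepth 10000 in
theorem exists_blockKind_mask : ∀ r c, blockKind r c 1 1 ≠ (0, 0) →
    ∃ k : Fin 4, (∀ i j, decide (blockKind r c i j ≠ (0, 0)) = cornerTurn k i j) ∨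
      (∀ i j, decide (blockKind r c i j ≠ (0, 0)) = sideTurn k i j) ∨
      ∀ i j, decide (blockKind r c i j ≠ (0, 0)) = true := by
  decide

/-- With `solid_of_matches_keepTables`, this reduces the tables of kept patterns to one condition on
the centre: in a neighbourhood that is not forbidden, a cell is kept exactly when it is solid. -/
theorem exists_mem_keepTables {τ : TileSet T} {P : Matrix (Fin 3) (Fin 3) (State T)}
    (hP : Allowed τ P) (h : P 1 1 ∈ solid T) : ∃ M ∈ keepTables T, Matches P M := by
  obtain ⟨⟨r, c, hrc⟩, -⟩ := allowed_iff.1 hP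
  rw [mem_solid_iff, hrc] at h
  have key := exists_blockKind_mask r c h
  simp only [← hrc] at key
  obtain ⟨k, hk | hk | hk⟩ := key
  · exact ⟨_, mem_keepTables_iff.2 (.inl ⟨k, .inl rfl⟩), fun i j => mem_maskSet.2 (hk i j)⟩
  · exact ⟨_, mem_keepTables_iff.2 (.inl ⟨k, .inr rfl⟩), fun i j => mem_maskSet.2 (hk i j)⟩
  · exact ⟨_, mem_keepTables_iff.2 (.inr rfl), fun i j => mem_maskSet.2 (hk i j)⟩

end TileCA

/-! ### The local rule: persistence of solids, motion of particles, locality. -/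

namespace TileCA
variable {T : Type u}

/-! ### The local rule in coordinates -/

/-- The `3 × 3` pattern of `v` around `(x, y)`. -/
def window {B : Type u} (v : Config B) (x y : ℤ) : Matrix (Fin 3) (Fin 3) B :=
  fun i j => v (x + ((j : ℕ) : ℤ) - 1, y + 1 - ((i : ℕ) : ℤ))

theorem block_neighbourhood {B : Type u} (v : Config B) (x y : ℤ) (r c : Fin 3) :
    block (neighbourhood v (x, y)) r c =
      window v (x + ((c : ℕ) : ℤ) - 1) (y + 1 - ((r : ℕ) : ℤ)) := by
  ext i j
  simp only [block, neighbourhood, window]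
  congr 2 <;> push_cast <;> ring

/-- All `3 × 3` patterns seen from `(x, y)` are allowed. -/
def OkAt (τ : TileSet T) (v : Config (State T)) (x y : ℤ) : Prop :=
  ∀ x' y', |x' - x| ≤ 1 → |y' - y| ≤ 1 → Allowed τ (window v x' y')

/-- The pattern around `(x, y)` sends the cell to `U`. -/
def UpAt (v : Config (State T)) (x y : ℤ) : Prop := ∃ M ∈ upTables T, Matches (window v x y) M

/-- The pattern around `(x, y)` sends the cell to `D`. -/
def DownAt (v : Config (State T)) (x y : ℤ) : Prop :=
  ∃ M ∈ downTables T, Matches (window v x y) M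

theorem forbidden_neighbourhood_iff {τ : TileSet T} {v : Config (State T)} {x y : ℤ} :
    Forbidden τ (neighbourhood v (x, y)) ↔ ¬ OkAt τ v x y := by
  simp only [Forbidden, block_neighbourhood, OkAt, not_forall]
  constructor
  · rintro ⟨r, c, h⟩
    have := r.2
    have := c.2
    exact ⟨_, _, abs_le.2 (by omega), abs_le.2 (by omega), h⟩
  · rintro ⟨x', y', hx, hy, h⟩
    rw [abs_le] at hx hy
    refine ⟨⟨(y + 1 - y').toNat, by omega⟩, ⟨(x' - x + 1).toNat, by omega⟩, ?_⟩
    convert h using 3 <;> push_cast <;> omega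

theorem matches_iff {P : Matrix (Fin 3) (Fin 3) (State T)} {a b c d e f g h i : Set (State T)} :
    Matches P !![a, b, c; d, e, f; g, h, i] ↔
      (P 0 0 ∈ a ∧ P 0 1 ∈ b ∧ P 0 2 ∈ c) ∧ (P 1 0 ∈ d ∧ P 1 1 ∈ e ∧ P 1 2 ∈ f) ∧
        P 2 0 ∈ g ∧ P 2 1 ∈ h ∧ P 2 2 ∈ i := by
  simp only [Matches, Fin.forall_fin_succ]
  simp

theorem window_eq {B : Type u} (v : Config B) (x y : ℤ) : window v x y =
    !![v (x - 1, y + 1), v (x, y + 1), v (x + 1, y + 1); v (x - 1, y), v (x, y), v (x + 1, y);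
      v (x - 1, y - 1), v (x, y - 1), v (x + 1, y - 1)] := by
  ext i j
  fin_cases i <;> fin_cases j <;> simp only [window] <;>
    exact congrArg v (by ext <;> simp <;> try ring)

theorem matches_window_iff {v : Config (State T)} {x y : ℤ} {a b c d e f g h i : Set (State T)} :
    Matches (window v x y) !![a, b, c; d, e, f; g, h, i] ↔
      (v (x - 1, y + 1) ∈ a ∧ v (x, y + 1) ∈ b ∧ v (x + 1, y + 1) ∈ c) ∧
      (v (x - 1, y) ∈ d ∧ v (x, y) ∈ e ∧ v (x + 1, y) ∈ f) ∧
        v (x - 1, y - 1) ∈ g ∧ v (x, y - 1) ∈ h ∧ v (x + 1, y - 1) ∈ i := by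
  rw [window_eq, matches_iff]
  rfl

theorem window_center {B : Type u} (v : Config B) (x y : ℤ) : window v x y 1 1 = v (x, y) := by
  rw [window_eq]; rfl

variable {τ : TileSet T} {v : Config (State T)} {x y : ℤ}

theorem tileCA_eq_O_of_not_okAt (h : ¬ OkAt τ v x y) : tileCA τ v (x, y) = .O := by
  rw [tileCA, localRule, if_pos (forbidden_neighbourhood_iff.2 h)]

theorem neighbourhood_center : neighbourhood v (x, y) 2 2 = v (x, y) := by
  simp [neighbourhood]

open Classical in
theorem tileCA_of_okAt (h : OkAt τ v x y) : tileCA τ v (x, y) =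
    if v (x, y) ∈ solid T then v (x, y) else if UpAt v x y then .U
      else if DownAt v x y then .D else .O := by
  have hw : block (neighbourhood v (x, y)) 1 1 = window v x y := by
    rw [block_neighbourhood]; simp
  have hk : (∃ M ∈ keepTables T, Matches (window v x y) M) ↔ v (x, y) ∈ solid T := by
    rw [← window_center v]
    exact ⟨fun ⟨M, hM, hm⟩ => solid_of_matches_keepTables hM hm,
      exists_mem_keepTables (h x y (by simp) (by simp))⟩
  rw [tileCA, localRule, if_neg (by rw [forbidden_neighbourhood_iff]; exact not_not.2 h)]
  simp only [hw, hk, neighbourhood_center, UpAt, DownAt]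
  congr

theorem U_notMem_solid : (State.U : State T) ∉ solid T := by simp [mem_solid_iff]
theorem D_notMem_solid : (State.D : State T) ∉ solid T := by simp [mem_solid_iff]
theorem O_notMem_solid : (State.O : State T) ∉ solid T := by simp [mem_solid_iff]

theorem tileCA_of_solid (h : OkAt τ v x y) (hs : v (x, y) ∈ solid T) :
    tileCA τ v (x, y) = v (x, y) := by
  rw [tileCA_of_okAt h, if_pos hs]

theorem of_tileCA_solid (h : tileCA τ v (x, y) ∈ solid T) :
    OkAt τ v x y ∧ v (x, y) ∈ solid T ∧ tileCA τ v (x, y) = v (x, y) := by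
  by_cases ho : OkAt τ v x y
  · rw [tileCA_of_okAt ho] at h ⊢
    split_ifs at h with h1
    · exact ⟨ho, h1, if_pos h1⟩
    · exact absurd h U_notMem_solid
    · exact absurd h D_notMem_solid
    · exact absurd h O_notMem_solid
  · rw [tileCA_eq_O_of_not_okAt ho] at h
    exact absurd h O_notMem_solid

theorem upAt_of_tileCA_eq_U (h : tileCA τ v (x, y) = .U) : UpAt v x y := by
  by_cases ho : OkAt τ v x y
  · rw [tileCA_of_okAt ho] at h
    split_ifs at h with h1 h2
    · rw [h] at h1
      exact absurd h1 U_notMem_solid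
    · exact h2
  · rw [tileCA_eq_O_of_not_okAt ho] at h
    cases h

theorem downAt_of_tileCA_eq_D (h : tileCA τ v (x, y) = .D) : DownAt v x y := by
  by_cases ho : OkAt τ v x y
  · rw [tileCA_of_okAt ho] at h
    split_ifs at h with h1 h2 h3
    · rw [h] at h1
      exact absurd h1 D_notMem_solid
    · exact h3
  · rw [tileCA_eq_O_of_not_okAt ho] at h
    cases h

/-- Where the `U` comes from, and what is next to it. -/
theorem UpAt.cases (h : UpAt v x y) : v (x, y) = .O ∧
    (v (x, y - 1) = .U ∧ v (x - 1, y - 1) ∈ solid T ∨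
     v (x + 1, y) = .U ∧ (v (x, y - 1) ∈ solid T ∨ v (x + 1, y - 1) ∈ solid T ∨
        v (x + 1, y - 1) = .D) ∨
     v (x, y + 1) = .U ∧ v (x - 1, y) = .O ∧ v (x - 1, y + 1) = .O ∧ v (x + 1, y) ∈ solid T) := by
  obtain ⟨M, hM, hm⟩ := h
  simp only [upTables, Set.mem_insert_iff, Set.mem_singleton_iff] at hM
  rcases hM with rfl | rfl | rfl | rfl | rfl | rfl | rfl <;>
    obtain ⟨⟨h00, h01, h02⟩, ⟨h10, h11, h12⟩, h20, h21, h22⟩ := matches_window_iff.1 hm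
  · exact ⟨h11, .inl ⟨h21, h20⟩⟩
  · exact ⟨h11, .inl ⟨h21, h20⟩⟩
  · exact ⟨h11, .inr (.inl ⟨h12, .inl h21⟩)⟩
  · exact ⟨h11, .inr (.inl ⟨h12, .inr (.inl h22)⟩)⟩
  · exact ⟨h11, .inr (.inr ⟨h01, h10, h00, h12⟩)⟩
  · exact ⟨h11, .inr (.inr ⟨h01, h10, h00, h12⟩)⟩
  · exact ⟨h11, .inr (.inl ⟨h12, .inr (.inr h22)⟩)⟩

theorem DownAt.cases (h : DownAt v x y) : v (x, y) = .O ∧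
    (v (x, y + 1) = .D ∧ v (x - 1, y + 1) ∈ solid T ∨
     v (x + 1, y) = .D ∧ (v (x, y + 1) ∈ solid T ∨ v (x + 1, y + 1) ∈ solid T ∨
        v (x + 1, y + 1) = .U) ∨
     v (x, y - 1) = .D ∧ v (x - 1, y) = .O ∧ v (x - 1, y - 1) = .O ∧ v (x + 1, y) ∈ solid T) := by
  obtain ⟨M, hM, hm⟩ := h
  simp only [downTables, Set.mem_insert_iff, Set.mem_singleton_iff] at hM
  rcases hM with rfl | rfl | rfl | rfl | rfl | rfl | rfl <;>
    obtain ⟨⟨h00, h01, h02⟩, ⟨h10, h11, h12⟩, h20, h21, h22⟩ := matches_window_iff.1 hm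
  · exact ⟨h11, .inl ⟨h01, h00⟩⟩
  · exact ⟨h11, .inl ⟨h01, h00⟩⟩
  · exact ⟨h11, .inr (.inl ⟨h12, .inl h01⟩)⟩
  · exact ⟨h11, .inr (.inl ⟨h12, .inr (.inl h02)⟩)⟩
  · exact ⟨h11, .inr (.inr ⟨h21, h10, h20, h12⟩)⟩
  · exact ⟨h11, .inr (.inr ⟨h21, h10, h20, h12⟩)⟩
  · exact ⟨h11, .inr (.inl ⟨h12, .inr (.inr h02)⟩)⟩

theorem tileCA_eq_U (ho : OkAt τ v x y) (h : UpAt v x y) : tileCA τ v (x, y) = .U := by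
  rw [tileCA_of_okAt ho, if_neg (by rw [h.cases.1]; exact O_notMem_solid), if_pos h]

theorem tileCA_eq_D (ho : OkAt τ v x y) (h : DownAt v x y) (hu : ¬ UpAt v x y) :
    tileCA τ v (x, y) = .D := by
  rw [tileCA_of_okAt ho, if_neg (by rw [h.cases.1]; exact O_notMem_solid), if_neg hu, if_pos h]

theorem tileCA_eq_O (hs : v (x, y) ∉ solid T) (hu : ¬ UpAt v x y) (hd : ¬ DownAt v x y) :
    tileCA τ v (x, y) = .O := by
  by_cases ho : OkAt τ v x y
  · rw [tileCA_of_okAt ho, if_neg hs, if_neg hu, if_neg hd]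
  · exact tileCA_eq_O_of_not_okAt ho

/-- A `U` moves to at most one cell. -/
theorem UpAt.unique {x' y' a b : ℤ} (h : UpAt v x y) (h' : UpAt v x' y')
    (hp : ∀ p q, |p - x| + |q - y| ≤ 1 → v (p, q) = .U → p = a ∧ q = b)
    (hp' : ∀ p q, |p - x'| + |q - y'| ≤ 1 → v (p, q) = .U → p = a ∧ q = b) :
    x = x' ∧ y = y' := by
  -- Seen from the `U` at `(a, b)`, the three targets exclude one another. A move north needs a
  -- solid cell to the west, and the others need `O` there; a move west needs something other than
  -- `O` below or diagonally below on the west, and a move south needs `O` in both cells.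
  have key : ∀ x y, UpAt v x y → (∀ p q, |p - x| + |q - y| ≤ 1 → v (p, q) = .U → p = a ∧ q = b) →
      x = a ∧ y = b + 1 ∧ v (a - 1, b) ∈ solid T ∨
      x = a - 1 ∧ y = b ∧ v (a - 1, b) = .O ∧ (v (a - 1, b - 1) ∈ solid T ∨ v (a, b - 1) ≠ .O) ∨
      x = a ∧ y = b - 1 ∧ v (a, b - 1) = .O ∧ v (a - 1, b) = .O ∧ v (a - 1, b - 1) = .O := by
    intro x y h hp
    obtain ⟨h0, ⟨h1, h2⟩ | ⟨h1, h2⟩ | ⟨h1, h2, h3, h4⟩⟩ := h.cases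
    · obtain ⟨rfl, rfl⟩ := hp _ _ (by simp) h1
      exact .inl ⟨rfl, by ring, h2⟩
    · obtain ⟨rfl, rfl⟩ := hp _ _ (by simp) h1
      refine .inr (.inl ⟨by ring, rfl, by simpa using h0, ?_⟩)
      rcases h2 with h2 | h2 | h2
      · exact .inl (by simpa using h2)
      · exact .inr fun h => O_notMem_solid (h ▸ h2)
      · exact .inr fun h => by rw [h] at h2; cases h2
    · obtain ⟨rfl, rfl⟩ := hp _ _ (by simp) h1
      exact .inr (.inr ⟨rfl, by ring, by simpa using h0, h3, by simpa using h2⟩)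
  have hO := O_notMem_solid (T := T)
  rcases key x y h hp with ⟨e1, e2, h1⟩ | ⟨e1, e2, h1, h2⟩ | ⟨e1, e2, h1, h2, h3⟩ <;>
  rcases key x' y' h' hp' with ⟨e1', e2', h1'⟩ | ⟨e1', e2', h1', h2'⟩ | ⟨e1', e2', h1', h2', h3'⟩
  · exact ⟨by omega, by omega⟩
  · exact absurd (h1' ▸ h1) hO
  · exact absurd (h2' ▸ h1) hO
  · exact absurd (h1 ▸ h1') hO
  · exact ⟨by omega, by omega⟩
  · exact (h2.elim (fun h => hO (h3' ▸ h)) fun h => h h1').elim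
  · exact absurd (h2 ▸ h1') hO
  · exact (h2'.elim (fun h => hO (h3 ▸ h)) fun h => h h1).elim
  · exact ⟨by omega, by omega⟩

/-- A `D` moves to at most one cell. -/
theorem DownAt.unique {x' y' a b : ℤ} (h : DownAt v x y) (h' : DownAt v x' y')
    (hp : ∀ p q, |p - x| + |q - y| ≤ 1 → v (p, q) = .D → p = a ∧ q = b)
    (hp' : ∀ p q, |p - x'| + |q - y'| ≤ 1 → v (p, q) = .D → p = a ∧ q = b) :
    x = x' ∧ y = y' := by
  have key : ∀ x y, DownAt v x y →
      (∀ p q, |p - x| + |q - y| ≤ 1 → v (p, q) = .D → p = a ∧ q = b) →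
      x = a ∧ y = b - 1 ∧ v (a - 1, b) ∈ solid T ∨
      x = a - 1 ∧ y = b ∧ v (a - 1, b) = .O ∧ (v (a - 1, b + 1) ∈ solid T ∨ v (a, b + 1) ≠ .O) ∨
      x = a ∧ y = b + 1 ∧ v (a, b + 1) = .O ∧ v (a - 1, b) = .O ∧ v (a - 1, b + 1) = .O := by
    intro x y h hp
    obtain ⟨h0, ⟨h1, h2⟩ | ⟨h1, h2⟩ | ⟨h1, h2, h3, h4⟩⟩ := h.cases
    · obtain ⟨rfl, rfl⟩ := hp _ _ (by simp) h1
      exact .inl ⟨rfl, by ring, h2⟩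
    · obtain ⟨rfl, rfl⟩ := hp _ _ (by simp) h1
      refine .inr (.inl ⟨by ring, rfl, by simpa using h0, ?_⟩)
      rcases h2 with h2 | h2 | h2
      · exact .inl (by simpa using h2)
      · exact .inr fun h => O_notMem_solid (h ▸ h2)
      · exact .inr fun h => by rw [h] at h2; cases h2
    · obtain ⟨rfl, rfl⟩ := hp _ _ (by simp) h1
      exact .inr (.inr ⟨rfl, by ring, by simpa using h0, h3, by simpa using h2⟩)
  have hO := O_notMem_solid (T := T)
  rcases key x y h hp with ⟨e1, e2, h1⟩ | ⟨e1, e2, h1, h2⟩ | ⟨e1, e2, h1, h2, h3⟩ <;>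
  rcases key x' y' h' hp' with ⟨e1', e2', h1'⟩ | ⟨e1', e2', h1', h2'⟩ | ⟨e1', e2', h1', h2', h3'⟩
  · exact ⟨by omega, by omega⟩
  · exact absurd (h1' ▸ h1) hO
  · exact absurd (h2' ▸ h1) hO
  · exact absurd (h1 ▸ h1') hO
  · exact ⟨by omega, by omega⟩
  · exact (h2.elim (fun h => hO (h3' ▸ h)) fun h => h h1').elim
  · exact absurd (h2 ▸ h1') hO
  · exact (h2'.elim (fun h => hO (h3 ▸ h)) fun h => h h1).elim
  · exact ⟨by omega, by omega⟩

/-! ### Locality -/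

theorem tileCA_congr {w : Config (State T)}
    (h : ∀ x' y', |x' - x| ≤ 2 → |y' - y| ≤ 2 → v (x', y') = w (x', y')) :
    tileCA τ v (x, y) = tileCA τ w (x, y) := by
  simp only [tileCA]
  congr 1
  ext i j
  have := i.2
  have := j.2
  exact h _ _ (abs_le.2 (by simp only; omega)) (abs_le.2 (by simp only; omega))

theorem iterate_tileCA_congr {w : Config (State T)} (t : ℕ)
    (h : ∀ x' y', |x' - x| ≤ 2 * t → |y' - y| ≤ 2 * t → v (x', y') = w (x', y')) :
    (tileCA τ)^[t] v (x, y) = (tileCA τ)^[t] w (x, y) := by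
  induction t generalizing x y with
  | zero => exact h x y (by simp) (by simp)
  | succ t ih =>
    rw [Function.iterate_succ_apply', Function.iterate_succ_apply']
    refine tileCA_congr fun x' y' hx hy => ih fun x'' y'' hx' hy' => h _ _ ?_ ?_ <;>
    · rw [abs_le] at *
      push_cast
      constructor <;> linarith

/-- The set of solid cells only shrinks, and a solid cell keeps its state as long as it lasts. -/
theorem solid_of_iterate_solid {t : ℕ} (h : (tileCA τ)^[t] v (x, y) ∈ solid T) :
    v (x, y) ∈ solid T ∧ (tileCA τ)^[t] v (x, y) = v (x, y) := by
  induction t with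
  | zero => exact ⟨h, rfl⟩
  | succ t ih =>
    rw [Function.iterate_succ_apply'] at h ⊢
    obtain ⟨-, h2, h3⟩ := of_tileCA_solid h
    rw [h3]
    exact ih h2

end TileCA

/-! ### Rectangular shape of the solid components. -/

namespace TileCA
variable {T : Type u}

/-! ### Obstacles of admissible configurations -/

/-- All `3 × 3` patterns are allowed. -/
def Admissible (τ : TileSet T) (z : Config (State T)) : Prop :=
  ∀ x y, Allowed τ (window z x y)

/-- The class of `x` in the segment from `first` to `last`. -/
def segClass (first last x : ℤ) : Fin 4 := if x = first then 1 else if x = last then 3 else 2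

/-- `z` has an obstacle with columns `xl..xr` and rows `yb..yt`, surrounded by liquid. -/
structure IsObstacle (z : Config (State T)) (xl xr yb yt : ℤ) : Prop where
  width : xl + 3 ≤ xr
  height : yb + 3 ≤ yt
  kind_eq : ∀ x y, xl ≤ x → x ≤ xr → yb ≤ y → y ≤ yt →
    kind (z (x, y)) = (segClass yt yb y, segClass xl xr x)
  ring : ∀ x y, xl - 2 ≤ x → x ≤ xr + 2 → yb - 2 ≤ y → y ≤ yt + 2 →
    (x < xl ∨ xr < x ∨ y < yb ∨ yt < y) → kind (z (x, y)) = (0, 0)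

theorem segClass_ne_zero (a b x : ℤ) : segClass a b x ≠ 0 := by
  unfold segClass
  split_ifs <;> decide

theorem IsObstacle.solid {z : Config (State T)} {xl xr yb yt : ℤ} (h : IsObstacle z xl xr yb yt)
    {x y : ℤ} (h1 : xl ≤ x) (h2 : x ≤ xr) (h3 : yb ≤ y) (h4 : y ≤ yt) : z (x, y) ∈ solid T := by
  rw [mem_solid_iff, h.kind_eq x y h1 h2 h3 h4]
  exact fun h => segClass_ne_zero yt yb y (congrArg Prod.fst h)

/-- A segment of nonzero classes, followed to the right. -/
theorem exists_right_end {f : ℤ → Fin 4} {B x₀ : ℤ} (hB : ∀ x, f x ≠ 0 → x ≤ B)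
    (hf : ∀ x, f x = 1 ∨ f x = 2 → f (x + 1) = 2 ∨ f (x + 1) = 3) (h0 : f x₀ ≠ 0) :
    ∃ b, x₀ ≤ b ∧ f b = 3 ∧ ∀ x, x₀ < x → x < b → f x = 2 := by
  have ne0 : ∀ a : Fin 4, a ≠ 0 → a = 3 ∨ a = 1 ∨ a = 2 := by decide
  rcases ne0 _ h0 with h | h
  · exact ⟨x₀, le_rfl, h, fun x h1 h2 => by omega⟩
  have step : ∀ n : ℕ, (∃ b, x₀ ≤ b ∧ f b = 3 ∧ ∀ x, x₀ < x → x < b → f x = 2) ∨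
      ∀ x, x₀ < x → x ≤ x₀ + n → f x = 2 := by
    intro n
    induction n with
    | zero => exact .inr fun x h1 h2 => by push_cast at h2; omega
    | succ n ih =>
      refine ih.elim .inl fun ih => ?_
      have hn : f (x₀ + n) = 1 ∨ f (x₀ + n) = 2 := by
        rcases Nat.eq_zero_or_pos n with rfl | hn
        · simpa using h
        · exact .inr (ih _ (by omega) le_rfl)
      rcases hf _ hn with h' | h'
      · refine .inr fun x h1 h2 => ?_
        rcases eq_or_ne x (x₀ + n + 1) with rfl | hx
        · exact h'
        · exact ih x h1 (by push_cast at h2; omega)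
      · exact .inl ⟨_, by omega, h', fun x h1 h2 => ih x h1 (by omega)⟩
  refine (step (B + 1 - x₀).toNat).elim id fun h' => ?_
  have hx₀ := hB _ h0
  have := hB (B + 1) (by rw [h' _ (by omega) (by omega)]; decide)
  omega

/-- A first or middle class can only continue with middle classes until a last class; bounded
support rules out an infinite continuation. The same applies in the other direction. -/
theorem exists_segment {f : ℤ → Fin 4} {B x₀ : ℤ} (hB : ∀ x, f x ≠ 0 → |x| ≤ B)
    (hf : ∀ x, f x = 1 ∨ f x = 2 → f (x + 1) = 2 ∨ f (x + 1) = 3)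
    (hf' : ∀ x, f x = 3 ∨ f x = 2 → f (x - 1) = 2 ∨ f (x - 1) = 1) (h0 : f x₀ ≠ 0) :
    ∃ a b, a ≤ x₀ ∧ x₀ ≤ b ∧ a < b ∧ ∀ x, a ≤ x → x ≤ b → f x = segClass a b x := by
  -- Negation in `Fin 4` exchanges the first and last classes and fixes the middle one and `0`, so
  -- `x ↦ -f (-x)` is the mirror image of `f` and the left end is found as a right end.
  have n1 : ∀ a : Fin 4, -a = 1 ↔ a = 3 := by decide
  have n2 : ∀ a : Fin 4, -a = 2 ↔ a = 2 := by decide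
  have n3 : ∀ a : Fin 4, -a = 3 ↔ a = 1 := by decide
  obtain ⟨a, ha, fa, ha'⟩ := exists_right_end (f := fun x => -f (-x)) (B := B) (x₀ := -x₀)
    (fun x hx => by have := abs_le.1 (hB (-x) (by simpa using hx)); omega)
    (fun x hx => by
      simp only [n1, n2, n3, neg_add] at hx ⊢
      exact hf' _ hx) (by simpa using h0)
  simp only [n3, n2] at fa ha'
  obtain ⟨b, hb, fb, hb'⟩ := exists_right_end (x₀ := -a)
    (fun x hx => (abs_le.1 (hB x hx)).2) hf (by rw [fa]; decide)
  have hab : -a ≠ b := by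
    rintro rfl
    rw [fa] at fb
    exact absurd fb (by decide)
  refine ⟨-a, b, by omega, ?_, by omega, fun x h1 h2 => ?_⟩
  · by_contra hlt
    have := ha' (-b) (by omega) (by omega)
    rw [neg_neg, fb] at this
    exact absurd this (by decide)
  · unfold segClass
    split_ifs with h3 h4
    · rw [h3, fa]
    · rw [h4, fb]
    · exact hb' x (by omega) (by omega)

variable {τ : TileSet T} {z : Config (State T)}

/-- The kinds in the `3 × 3` pattern around `(x, y)`. -/
theorem Admissible.exists_block (hz : Admissible τ z) (x y : ℤ) : ∃ r c,
    (kind (z (x - 1, y + 1)) = blockKind r c 0 0 ∧ kind (z (x, y + 1)) = blockKind r c 0 1 ∧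
      kind (z (x + 1, y + 1)) = blockKind r c 0 2) ∧
    (kind (z (x - 1, y)) = blockKind r c 1 0 ∧ kind (z (x, y)) = blockKind r c 1 1 ∧
      kind (z (x + 1, y)) = blockKind r c 1 2) ∧
    kind (z (x - 1, y - 1)) = blockKind r c 2 0 ∧ kind (z (x, y - 1)) = blockKind r c 2 1 ∧
      kind (z (x + 1, y - 1)) = blockKind r c 2 2 := by
  obtain ⟨⟨r, c, h⟩, -⟩ := allowed_iff.1 (hz x y)
  rw [window_eq] at h
  exact ⟨r, c, ⟨h 0 0, h 0 1, h 0 2⟩, ⟨h 1 0, h 1 1, h 1 2⟩, h 2 0, h 2 1, h 2 2⟩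

/-- This and the following finite checks on the picture are the only facts about allowed patterns
from which the shape of obstacles is derived. Horizontal neighbours in an obstacle share the row
class, vertical ones the column class. -/
theorem blockKind_right : ∀ r c, (blockKind r c 1 1).2 = 1 ∨ (blockKind r c 1 1).2 = 2 →
    (blockKind r c 1 2).1 = (blockKind r c 1 1).1 ∧
      ((blockKind r c 1 2).2 = 2 ∨ (blockKind r c 1 2).2 = 3) := by decide

theorem blockKind_left : ∀ r c, (blockKind r c 1 1).2 = 3 ∨ (blockKind r c 1 1).2 = 2 →
    (blockKind r c 1 0).1 = (blockKind r c 1 1).1 ∧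
      ((blockKind r c 1 0).2 = 2 ∨ (blockKind r c 1 0).2 = 1) := by decide

theorem blockKind_down : ∀ r c, (blockKind r c 1 1).1 = 1 ∨ (blockKind r c 1 1).1 = 2 →
    (blockKind r c 2 1).2 = (blockKind r c 1 1).2 ∧
      ((blockKind r c 2 1).1 = 2 ∨ (blockKind r c 2 1).1 = 3) := by decide

theorem blockKind_up : ∀ r c, (blockKind r c 1 1).1 = 3 ∨ (blockKind r c 1 1).1 = 2 →
    (blockKind r c 0 1).2 = (blockKind r c 1 1).2 ∧
      ((blockKind r c 0 1).1 = 2 ∨ (blockKind r c 0 1).1 = 1) := by decide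

theorem blockKind_west_end : ∀ r c, ((blockKind r c 1 0).2 = 1 →
      (blockKind r c 1 1).2 = 2 ∧ (blockKind r c 1 2).2 = 2) ∧
    ((blockKind r c 1 2).2 = 1 → blockKind r c 1 0 = (0, 0) ∧ blockKind r c 1 1 = (0, 0)) := by
  decide

theorem blockKind_east_end : ∀ r c, (blockKind r c 1 0).2 = 3 →
    blockKind r c 1 1 = (0, 0) ∧ blockKind r c 1 2 = (0, 0) := by decide

theorem blockKind_north_end : ∀ r c, ((blockKind r c 0 1).1 = 1 →
      (blockKind r c 1 1).1 = 2 ∧ (blockKind r c 2 1).1 = 2) ∧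
    ((blockKind r c 2 1).1 = 1 → blockKind r c 0 1 = (0, 0) ∧ blockKind r c 1 1 = (0, 0)) := by
  decide

theorem blockKind_south_end : ∀ r c, (blockKind r c 0 1).1 = 3 →
    blockKind r c 1 1 = (0, 0) ∧ blockKind r c 2 1 = (0, 0) := by decide

theorem blockKind_northeast : ∀ r c, blockKind r c 2 0 = (1, 3) →
    blockKind r c 1 1 = (0, 0) ∧ blockKind r c 0 1 = (0, 0) ∧
      blockKind r c 1 2 = (0, 0) ∧ blockKind r c 0 2 = (0, 0) := by decide

theorem blockKind_northwest : ∀ r c, blockKind r c 2 2 = (1, 1) →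
    blockKind r c 1 1 = (0, 0) ∧ blockKind r c 0 1 = (0, 0) ∧
      blockKind r c 1 0 = (0, 0) ∧ blockKind r c 0 0 = (0, 0) := by decide

theorem blockKind_southeast : ∀ r c, blockKind r c 0 0 = (3, 3) →
    blockKind r c 1 1 = (0, 0) ∧ blockKind r c 2 1 = (0, 0) ∧
      blockKind r c 1 2 = (0, 0) ∧ blockKind r c 2 2 = (0, 0) := by decide

theorem blockKind_southwest : ∀ r c, blockKind r c 0 2 = (3, 1) →
    blockKind r c 1 1 = (0, 0) ∧ blockKind r c 2 1 = (0, 0) ∧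
      blockKind r c 1 0 = (0, 0) ∧ blockKind r c 2 0 = (0, 0) := by decide

theorem blockKind_ne_zero : ∀ r c, blockKind r c 1 1 ≠ (0, 0) →
    (blockKind r c 1 1).1 ≠ 0 ∧ (blockKind r c 1 1).2 ≠ 0 := by decide

theorem Admissible.right (hz : Admissible τ z) {x y : ℤ}
    (h : (kind (z (x, y))).2 = 1 ∨ (kind (z (x, y))).2 = 2) :
    (kind (z (x + 1, y))).1 = (kind (z (x, y))).1 ∧
      ((kind (z (x + 1, y))).2 = 2 ∨ (kind (z (x + 1, y))).2 = 3) := by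
  obtain ⟨r, c, -, ⟨-, h1, h2⟩, -⟩ := hz.exists_block x y
  rw [h1] at h ⊢
  rw [h2]
  exact blockKind_right r c h

theorem Admissible.left (hz : Admissible τ z) {x y : ℤ}
    (h : (kind (z (x, y))).2 = 3 ∨ (kind (z (x, y))).2 = 2) :
    (kind (z (x - 1, y))).1 = (kind (z (x, y))).1 ∧
      ((kind (z (x - 1, y))).2 = 2 ∨ (kind (z (x - 1, y))).2 = 1) := by
  obtain ⟨r, c, -, ⟨h2, h1, -⟩, -⟩ := hz.exists_block x y
  rw [h1] at h ⊢
  rw [h2]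
  exact blockKind_left r c h

theorem Admissible.down (hz : Admissible τ z) {x y : ℤ}
    (h : (kind (z (x, y))).1 = 1 ∨ (kind (z (x, y))).1 = 2) :
    (kind (z (x, y - 1))).2 = (kind (z (x, y))).2 ∧
      ((kind (z (x, y - 1))).1 = 2 ∨ (kind (z (x, y - 1))).1 = 3) := by
  obtain ⟨r, c, -, ⟨-, h1, -⟩, -, h2, -⟩ := hz.exists_block x y
  rw [h1] at h ⊢
  rw [h2]
  exact blockKind_down r c h

theorem Admissible.up (hz : Admissible τ z) {x y : ℤ}
    (h : (kind (z (x, y))).1 = 3 ∨ (kind (z (x, y))).1 = 2) :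
    (kind (z (x, y + 1))).2 = (kind (z (x, y))).2 ∧
      ((kind (z (x, y + 1))).1 = 2 ∨ (kind (z (x, y + 1))).1 = 1) := by
  obtain ⟨r, c, ⟨-, h2, -⟩, ⟨-, h1, -⟩, -⟩ := hz.exists_block x y
  rw [h1] at h ⊢
  rw [h2]
  exact blockKind_up r c h

theorem Admissible.kind_ne_zero (hz : Admissible τ z) {x y : ℤ} (h : kind (z (x, y)) ≠ (0, 0)) :
    (kind (z (x, y))).1 ≠ 0 ∧ (kind (z (x, y))).2 ≠ 0 := by
  obtain ⟨r, c, -, ⟨-, h1, -⟩, -⟩ := hz.exists_block x y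
  rw [h1] at h ⊢
  exact blockKind_ne_zero r c h

theorem segClass_left (a b : ℤ) : segClass a b a = 1 := if_pos rfl

theorem segClass_right {a b : ℤ} (h : a ≠ b) : segClass a b b = 3 := by
  rw [segClass, if_neg h.symm, if_pos rfl]

theorem segClass_of_ne_left {a b x : ℤ} (h : x ≠ a) : segClass a b x = 3 ∨ segClass a b x = 2 := by
  rw [segClass, if_neg h]
  split_ifs <;> simp

theorem segClass_of_ne_right {a b x : ℤ} (h : x ≠ b) :
    segClass a b x = 1 ∨ segClass a b x = 2 := by
  rw [segClass, if_neg h]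
  split_ifs <;> simp

/-- If the column classes of a row are those of a segment, the row class is constant. -/
theorem Admissible.row_class_eq (hz : Admissible τ z) {a b y : ℤ}
    (h : ∀ x, a ≤ x → x ≤ b → (kind (z (x, y))).2 = segClass a b x) {x : ℤ} (h1 : a ≤ x)
    (h2 : x ≤ b) : (kind (z (x, y))).1 = (kind (z (a, y))).1 := by
  induction x, h1 using Int.leInduction with
  | base => rfl
  | succ x h1 ih =>
    rw [← ih (by omega)]
    refine (hz.right ?_).1
    rw [h x h1 (by omega)]
    exact segClass_of_ne_right (by omega)

/-- The minimal size holds because in every block of the picture that starts with a first class, two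
middle classes follow. The ring is read off from the blocks centred just outside the four sides and
the four corners. -/
theorem Admissible.isObstacle (hz : Admissible τ z) {xl xr yb yt : ℤ} (hlr : xl < xr)
    (hbt : yb < yt) (h : ∀ x y, xl ≤ x → x ≤ xr → yb ≤ y → y ≤ yt →
      kind (z (x, y)) = (segClass yt yb y, segClass xl xr x)) : IsObstacle z xl xr yb yt := by
  refine ⟨?_, ?_, h, ?_⟩
  · obtain ⟨r, c, -, ⟨h1, h2, h3⟩, -⟩ := hz.exists_block (xl + 1) yt
    rw [add_sub_cancel_right, h xl yt (by omega) (by omega) (by omega) (by omega)] at h1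
    obtain ⟨e1, e2⟩ := (blockKind_west_end r c).1 (by rw [← h1]; exact segClass_left _ _)
    rw [← h2] at e1
    rw [← h3] at e2
    by_contra hlt
    rcases (show xr = xl + 1 ∨ xr = xl + 1 + 1 by omega) with hx | hx
    · rw [← hx] at e1
      rw [h xr yt (by omega) (by omega) (by omega) (by omega)] at e1
      simp only [segClass_right (show xl ≠ xr by omega)] at e1
      exact absurd e1 (by decide)
    · rw [← hx, h xr yt (by omega) (by omega) (by omega) (by omega)] at e2
      simp only [segClass_right (show xl ≠ xr by omega)] at e2
      exact absurd e2 (by decide)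
  · obtain ⟨r, c, ⟨-, h1, -⟩, ⟨-, h2, -⟩, -, h3, -⟩ := hz.exists_block xl (yt - 1)
    rw [sub_add_cancel, h xl yt (by omega) (by omega) (by omega) (by omega)] at h1
    obtain ⟨e1, e2⟩ := (blockKind_north_end r c).1 (by rw [← h1, segClass_left])
    rw [← h2] at e1
    rw [← h3] at e2
    by_contra hlt
    rcases (show yb = yt - 1 ∨ yb = yt - 1 - 1 by omega) with hx | hx
    · rw [← hx] at e1
      rw [h xl yb (by omega) (by omega) (by omega) (by omega)] at e1
      simp only [segClass_right (show yt ≠ yb by omega)] at e1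
      exact absurd e1 (by decide)
    · rw [← hx, h xl yb (by omega) (by omega) (by omega) (by omega)] at e2
      simp only [segClass_right (show yt ≠ yb by omega)] at e2
      exact absurd e2 (by decide)
  · have east : ∀ y, yb ≤ y → y ≤ yt →
        kind (z (xr + 1, y)) = (0, 0) ∧ kind (z (xr + 1 + 1, y)) = (0, 0) := fun y h1 h2 => by
      obtain ⟨r, c, -, ⟨e1, e2, e3⟩, -⟩ := hz.exists_block (xr + 1) y
      rw [add_sub_cancel_right, h xr y (by omega) (by omega) h1 h2] at e1
      rw [e2, e3]
      exact blockKind_east_end r c (by rw [← e1, segClass_right (by omega)])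
    have west : ∀ y, yb ≤ y → y ≤ yt →
        kind (z (xl - 1 - 1, y)) = (0, 0) ∧ kind (z (xl - 1, y)) = (0, 0) := fun y h1 h2 => by
      obtain ⟨r, c, -, ⟨e1, e2, e3⟩, -⟩ := hz.exists_block (xl - 1) y
      rw [sub_add_cancel, h xl y (by omega) (by omega) h1 h2] at e3
      rw [e1, e2]
      exact (blockKind_west_end r c).2 (by rw [← e3, segClass_left])
    have north : ∀ x, xl ≤ x → x ≤ xr →
        kind (z (x, yt + 1 + 1)) = (0, 0) ∧ kind (z (x, yt + 1)) = (0, 0) := fun x h1 h2 => by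
      obtain ⟨r, c, ⟨-, e1, -⟩, ⟨-, e2, -⟩, -, e3, -⟩ := hz.exists_block x (yt + 1)
      rw [add_sub_cancel_right, h x yt h1 h2 (by omega) (by omega)] at e3
      rw [e1, e2]
      exact (blockKind_north_end r c).2 (by rw [← e3, segClass_left])
    have south : ∀ x, xl ≤ x → x ≤ xr →
        kind (z (x, yb - 1)) = (0, 0) ∧ kind (z (x, yb - 1 - 1)) = (0, 0) := fun x h1 h2 => by
      obtain ⟨r, c, ⟨-, e1, -⟩, ⟨-, e2, -⟩, -, e3, -⟩ := hz.exists_block x (yb - 1)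
      rw [sub_add_cancel, h x yb h1 h2 (by omega) (by omega)] at e1
      rw [e2, e3]
      exact blockKind_south_end r c (by rw [← e1, segClass_right (by omega)])
    have northeast : kind (z (xr + 1, yt + 1)) = (0, 0) ∧ kind (z (xr + 1, yt + 1 + 1)) = (0, 0) ∧
        kind (z (xr + 1 + 1, yt + 1)) = (0, 0) ∧ kind (z (xr + 1 + 1, yt + 1 + 1)) = (0, 0) := by
      obtain ⟨r, c, ⟨-, e01, e02⟩, ⟨-, e11, e12⟩, e20, -⟩ := hz.exists_block (xr + 1) (yt + 1)
      rw [add_sub_cancel_right, add_sub_cancel_right, h xr yt (by omega) (by omega) (by omega)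
        (by omega), segClass_left, segClass_right (by omega)] at e20
      rw [e01, e02, e11, e12]
      exact blockKind_northeast r c e20.symm
    have northwest : kind (z (xl - 1, yt + 1)) = (0, 0) ∧ kind (z (xl - 1, yt + 1 + 1)) = (0, 0) ∧
        kind (z (xl - 1 - 1, yt + 1)) = (0, 0) ∧ kind (z (xl - 1 - 1, yt + 1 + 1)) = (0, 0) := by
      obtain ⟨r, c, ⟨e00, e01, -⟩, ⟨e10, e11, -⟩, -, -, e22⟩ := hz.exists_block (xl - 1) (yt + 1)
      rw [sub_add_cancel, add_sub_cancel_right, h xl yt (by omega) (by omega) (by omega)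
        (by omega), segClass_left, segClass_left] at e22
      rw [e00, e01, e10, e11]
      exact blockKind_northwest r c e22.symm
    have southeast : kind (z (xr + 1, yb - 1)) = (0, 0) ∧ kind (z (xr + 1, yb - 1 - 1)) = (0, 0) ∧
        kind (z (xr + 1 + 1, yb - 1)) = (0, 0) ∧ kind (z (xr + 1 + 1, yb - 1 - 1)) = (0, 0) := by
      obtain ⟨r, c, ⟨e00, -, -⟩, ⟨-, e11, e12⟩, -, e21, e22⟩ := hz.exists_block (xr + 1) (yb - 1)
      rw [add_sub_cancel_right, sub_add_cancel, h xr yb (by omega) (by omega) (by omega)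
        (by omega), segClass_right (by omega), segClass_right (by omega)] at e00
      rw [e11, e12, e21, e22]
      exact blockKind_southeast r c e00.symm
    have southwest : kind (z (xl - 1, yb - 1)) = (0, 0) ∧ kind (z (xl - 1, yb - 1 - 1)) = (0, 0) ∧
        kind (z (xl - 1 - 1, yb - 1)) = (0, 0) ∧ kind (z (xl - 1 - 1, yb - 1 - 1)) = (0, 0) := by
      obtain ⟨r, c, ⟨-, -, e02⟩, ⟨e10, e11, -⟩, e20, e21, -⟩ := hz.exists_block (xl - 1) (yb - 1)
      rw [sub_add_cancel, sub_add_cancel, h xl yb (by omega) (by omega) (by omega)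
        (by omega), segClass_left, segClass_right (by omega)] at e02
      rw [e10, e11, e20, e21]
      exact blockKind_southwest r c e02.symm
    intro x y h1 h2 h3 h4 h5
    have hx : x = xl - 1 - 1 ∨ x = xl - 1 ∨ xl ≤ x ∧ x ≤ xr ∨ x = xr + 1 ∨ x = xr + 1 + 1 := by
      omega
    have hy : y = yb - 1 - 1 ∨ y = yb - 1 ∨ yb ≤ y ∧ y ≤ yt ∨ y = yt + 1 ∨ y = yt + 1 + 1 := by
      omega
    rcases hx with rfl | rfl | ⟨hx, hx'⟩ | rfl | rfl
    · rcases hy with rfl | rfl | ⟨hy, hy'⟩ | rfl | rfl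
      exacts [southwest.2.2.2, southwest.2.2.1, (west y hy hy').1, northwest.2.2.1,
        northwest.2.2.2]
    · rcases hy with rfl | rfl | ⟨hy, hy'⟩ | rfl | rfl
      exacts [southwest.2.1, southwest.1, (west y hy hy').2, northwest.1, northwest.2.1]
    · rcases hy with rfl | rfl | ⟨hy, hy'⟩ | rfl | rfl
      · exact (south x hx hx').2
      · exact (south x hx hx').1
      · omega
      · exact (north x hx hx').2
      · exact (north x hx hx').1
    · rcases hy with rfl | rfl | ⟨hy, hy'⟩ | rfl | rfl
      exacts [southeast.2.1, southeast.1, (east y hy hy').1, northeast.1, northeast.2.1]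
    · rcases hy with rfl | rfl | ⟨hy, hy'⟩ | rfl | rfl
      exacts [southeast.2.2.2, southeast.2.2.1, (east y hy hy').2, northeast.2.2.1,
        northeast.2.2.2]

/-- The row and the column through the given cell are segments. The column classes of that row
spread from row to row up to both ends of the column, which fills the rectangle. -/
theorem Admissible.exists_isObstacle (hz : Admissible τ z) {B : ℤ}
    (hB : ∀ x y, z (x, y) ∈ solid T → |x| ≤ B ∧ |y| ≤ B) {x₀ y₀ : ℤ} (h : z (x₀, y₀) ∈ solid T) :
    ∃ xl xr yb yt, IsObstacle z xl xr yb yt ∧ xl ≤ x₀ ∧ x₀ ≤ xr ∧ yb ≤ y₀ ∧ y₀ ≤ yt := by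
  have hB' : ∀ x y, kind (z (x, y)) ≠ (0, 0) → |x| ≤ B ∧ |y| ≤ B := fun x y h =>
    hB x y (mem_solid_iff.2 h)
  have h0 := hz.kind_ne_zero (mem_solid_iff.1 h)
  obtain ⟨xl, xr, hl, hr, hlr, hrow⟩ := exists_segment (f := fun x => (kind (z (x, y₀))).2) (B := B)
    (fun x hx => (hB' x y₀ fun h => hx (by rw [h])).1) (fun x hx => (hz.right hx).2)
    (fun x hx => (hz.left hx).2) h0.2
  -- Row classes are counted from north to south while `y` grows to the north, hence the sign.
  obtain ⟨a, b, hb, ht, hbt, hcol⟩ := exists_segment (f := fun y => (kind (z (x₀, -y))).1) (B := B)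
    (x₀ := -y₀) (fun y hy => abs_neg y ▸ (hB' x₀ (-y) fun h => hy (by rw [h])).2)
    (fun y hy => by
      have := (hz.down hy).2
      rwa [show -y - 1 = -(y + 1) by ring] at this)
    (fun y hy => by
      have := (hz.up hy).2
      rwa [show -y + 1 = -(y - 1) by ring] at this) (by simpa using h0.1)
  obtain ⟨yt, rfl⟩ : ∃ yt, a = -yt := ⟨-a, by ring⟩
  obtain ⟨yb, rfl⟩ : ∃ yb, b = -yb := ⟨-b, by ring⟩
  have hcol' : ∀ y, yb ≤ y → y ≤ yt → (kind (z (x₀, y))).1 = segClass yt yb y := fun y h1 h2 => by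
    have := hcol (-y) (by omega) (by omega)
    simpa only [segClass, neg_neg, neg_inj] using this
  have hclass : ∀ y, (∀ x, xl ≤ x → x ≤ xr → (kind (z (x, y))).2 = segClass xl xr x) →
      yb ≤ y → y ≤ yt → ∀ x, xl ≤ x → x ≤ xr → (kind (z (x, y))).1 = segClass yt yb y :=
    fun y hy h1 h2 x h3 h4 => by
      rw [hz.row_class_eq hy h3 h4, ← hz.row_class_eq hy hl hr, hcol' y h1 h2]
  have hrows : ∀ y, yb ≤ y → y ≤ yt → ∀ x, xl ≤ x → x ≤ xr →
      (kind (z (x, y))).2 = segClass xl xr x := by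
    intro y h1 h2
    rcases le_total y₀ y with hy | hy
    · induction y, hy using Int.leInduction with
      | base => exact hrow
      | succ y hy ih =>
        intro x h3 h4
        have ih := ih (by omega) (by omega)
        rw [← ih x h3 h4]
        refine (hz.up ?_).1
        rw [hclass y ih (by omega) (by omega) x h3 h4]
        exact segClass_of_ne_left (by omega)
    · induction y, hy using Int.leInductionDown with
      | base => exact hrow
      | pred y hy ih =>
        intro x h3 h4
        have ih := ih (by omega) (by omega)
        rw [← ih x h3 h4]
        refine (hz.down ?_).1
        rw [hclass y ih (by omega) (by omega) x h3 h4]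
        exact segClass_of_ne_right (by omega)
  have hkind : ∀ x y, xl ≤ x → x ≤ xr → yb ≤ y → y ≤ yt →
      kind (z (x, y)) = (segClass yt yb y, segClass xl xr x) := fun x y h1 h2 h3 h4 =>
    Prod.ext (hclass y (hrows y h3 h4) h3 h4 x h1 h2) (hrows y h3 h4 x h1 h2)
  exact ⟨xl, xr, yb, yt, hz.isObstacle hlr (by omega) hkind, hl, hr, by omega, by omega⟩

end TileCA

/-! ### Long-term behaviour of configurations with finite support. -/

namespace TileCA
variable {T : Type u} {τ : TileSet T}

/-! ### Limits of finite configurations -/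

/-- Liquid states are interchangeable in allowed patterns, so particles never make a pattern
forbidden. -/
theorem Allowed.congr {P Q : Matrix (Fin 3) (Fin 3) (State T)} (hP : Allowed τ P)
    (h : ∀ i j, Q i j = P i j ∨ Q i j ∈ liquid T ∧ P i j ∈ liquid T) : Allowed τ Q := by
  obtain ⟨⟨r, c, hrc⟩, h1, h2⟩ := allowed_iff.1 hP
  have hk : ∀ i j, kind (Q i j) = kind (P i j) := fun i j => by
    rcases h i j with h | ⟨h, h'⟩
    · rw [h]
    · rw [mem_liquid_iff.1 h, mem_liquid_iff.1 h']
  have ht : ∀ i j a, Q i j = .tile a → P i j = .tile a := fun i j a ha => by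
    rcases h i j with h | ⟨h, -⟩
    · rw [← h, ha]
    · rw [mem_liquid_iff, ha] at h
      exact absurd h (by simp [kind])
  exact allowed_iff.2 ⟨⟨r, c, fun i j => by rw [hk, hrc]⟩,
    fun i j j' hj a b ha hb => h1 i j j' hj a b (ht _ _ _ ha) (ht _ _ _ hb),
    fun i i' j hi a b ha hb => h2 i i' j hi a b (ht _ _ _ ha) (ht _ _ _ hb)⟩

theorem allowed_of_liquid {P : Matrix (Fin 3) (Fin 3) (State T)} (h : ∀ i j, P i j ∈ liquid T) :
    Allowed τ P := by
  refine allowed_iff.2 ⟨⟨0, 0, fun i j => ?_⟩, fun i j j' _ a b ha _ => ?_,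
    fun i i' j _ a b ha _ => ?_⟩
  · rw [mem_liquid_iff.1 (h i j)]
    revert i j
    decide
  all_goals
    have := mem_liquid_iff.1 (h i j)
    rw [ha] at this
    exact absurd this (by simp [kind])

theorem eq_U_or_D_or_O {a : State T} (h : a ∉ solid T) : a = .U ∨ a = .D ∨ a = .O := by
  rw [notMem_solid_iff] at h
  exact h

/-- Particles moving around static solid cells leave every half plane on the east. -/
theorem exists_forall_not_of_step {a : ℕ → ℤ → ℤ → Prop} {s : ℤ → ℤ → Prop} {B : ℤ} {t₀ : ℕ}
    (hs : ∀ x y, s x y → |y| ≤ B) (heast : ∀ t x y, B < x → ¬ a t x y)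
    (step : ∀ t, t₀ ≤ t → ∀ x y, a (t + 1) x y → a t x (y - 1) ∧ s (x - 1) (y - 1) ∨
      a t (x + 1) y ∨ a t x (y + 1) ∧ ¬ s (x - 1) y ∧ s (x + 1) y) (n : ℕ) :
    ∃ t₁, ∀ t, t₁ ≤ t → ∀ x y, B - n < x → ¬ a t x y := by
  induction n with
  | zero => exact ⟨0, fun t _ x y hx => heast t x y (by simpa using hx)⟩
  | succ n ih =>
    obtain ⟨t₁, ht₁⟩ := ih
    -- No particle can rest or enter this column from the east any more, so one found here has
    -- walked within the column. It cannot turn round: a step up needs a static solid cell west of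
    -- the cell it leaves, a step down needs none west of the cell it enters. All its steps thus
    -- pass solid cells on one side.
    have chain : ∀ t, t₀ ≤ t → t₁ ≤ t → ∀ i : ℕ, ∀ y, a (t + i) (B - n) y →
        (∀ j : ℕ, 1 ≤ j → j ≤ i → s (B - n - 1) (y - j)) ∨
        (1 ≤ i → ¬ s (B - n - 1) y) ∧ ∀ j : ℕ, j < i → s (B - n + 1) (y + j) := by
      intro t h0 h1 i
      induction i with
      | zero => exact fun y _ => .inl fun j h h' => by omega
      | succ i ih =>
        intro y hy
        rcases step (t + i) (by omega) _ _ hy with ⟨h2, h3⟩ | h2 | ⟨h2, h3, h4⟩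
        · refine .inl fun j hj hj' => ?_
          rcases ih _ h2 with h5 | ⟨h5, -⟩
          · rcases eq_or_ne j 1 with rfl | hj1
            · simpa using h3
            · have := h5 (j - 1) (by omega) (by omega)
              rwa [show y - 1 - ((j - 1 : ℕ) : ℤ) = y - j by omega] at this
          · obtain rfl : i = 0 := by
              by_contra hi
              exact h5 (by omega) h3
            obtain rfl : j = 1 := by omega
            simpa using h3
        · exact absurd h2 (ht₁ _ (by omega) _ _ (by omega))
        · refine .inr ⟨fun _ => h3, fun j hj => ?_⟩
          rcases ih _ h2 with h5 | ⟨-, h5⟩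
          · obtain rfl : i = 0 := by
              by_contra hi
              have := h5 1 le_rfl (by omega)
              simp at this
              exact h3 this
            obtain rfl : j = 0 := by omega
            simpa using h4
          · rcases eq_or_ne j 0 with rfl | hj0
            · simpa using h4
            · have := h5 (j - 1) (by omega)
              rwa [show y + 1 + ((j - 1 : ℕ) : ℤ) = y + j by omega] at this
    -- The walk passes solid cells in `k` consecutive rows, but only `2 * B + 1` rows can contain
    -- any.
    obtain ⟨k, hk2, hk⟩ : ∃ k : ℕ, 2 ≤ k ∧ 2 * B + 2 ≤ k :=
      ⟨(2 * B + 2).toNat + 2, by omega, by omega⟩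
    refine ⟨t₀ + t₁ + k, fun t ht x y hx hxy => ?_⟩
    rcases lt_or_ge (B - n) x with h | h
    · exact ht₁ t (by omega) x y h hxy
    obtain rfl : x = B - n := by push_cast at hx; omega
    obtain ⟨t', rfl⟩ : ∃ t', t = t' + k := ⟨t - k, by omega⟩
    rcases chain t' (by omega) (by omega) k y hxy with h | ⟨-, h⟩
    · have h1 := abs_le.1 (hs _ _ (h 1 le_rfl (by omega)))
      have h2 := abs_le.1 (hs _ _ (h k (by omega) le_rfl))
      push_cast at h1
      omega
    · have h1 := abs_le.1 (hs _ _ (h 0 (by omega)))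
      have h2 := abs_le.1 (hs _ _ (h (k - 1) (by omega)))
      omega

open Classical in
/-- The solid cells that persist forever, with `O` elsewhere. -/
noncomputable def limitConfig (τ : TileSet T) (v : Config (State T)) : Config (State T) :=
  fun p => if ∀ t, (tileCA τ)^[t] v p ∈ solid T then v p else .O

variable {v : Config (State T)} {B : ℤ}

theorem limitConfig_of_solid {p : ℤ × ℤ} (h : limitConfig τ v p ∈ solid T) (t : ℕ) :
    (tileCA τ)^[t] v p = limitConfig τ v p := by
  unfold limitConfig at h ⊢
  split_ifs at h ⊢ with h1
  · exact (solid_of_iterate_solid (h1 t)).2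
  · exact absurd h O_notMem_solid

theorem limitConfig_eq_O {p : ℤ × ℤ} (h : limitConfig τ v p ∉ solid T) :
    limitConfig τ v p = .O := by
  unfold limitConfig at h ⊢
  split_ifs at h ⊢ with h1
  · exact absurd (h1 0) h
  · rfl

theorem limitConfig_notMem_solid {p : ℤ × ℤ} {t : ℕ} (h : (tileCA τ)^[t] v p ∉ solid T) :
    limitConfig τ v p ∉ solid T := fun h' => h (limitConfig_of_solid h' t ▸ h')

theorem abs_le_of_solid {x y : ℤ} (hB : ∀ x y, v (x, y) ≠ .O → |x| ≤ B ∧ |y| ≤ B)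
    (h : v (x, y) ∈ solid T) : |x| ≤ B ∧ |y| ≤ B :=
  hB x y fun h' => O_notMem_solid (h' ▸ h)

/-- Solid cells persist from some time on. -/
theorem exists_solid_iff (hB : ∀ x y, v (x, y) ≠ .O → |x| ≤ B ∧ |y| ≤ B) :
    ∃ t₀, ∀ t, t₀ ≤ t → ∀ p,
      ((tileCA τ)^[t] v p ∈ solid T ↔ limitConfig τ v p ∈ solid T) := by
  have hfin : (Set.Icc (-B) B ×ˢ Set.Icc (-B) B).Finite :=
    (Set.finite_Icc _ _).prod (Set.finite_Icc _ _)
  -- Each cell loses solidity at most once, and only the finitely many cells of this box can ever be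
  -- solid.
  have key : ∀ᶠ t in Filter.atTop, ∀ p ∈ Set.Icc (-B) B ×ˢ Set.Icc (-B) B,
      ((tileCA τ)^[t] v p ∈ solid T → limitConfig τ v p ∈ solid T) := by
    rw [Filter.eventually_all_finite hfin]
    intro p _
    by_cases h : ∀ t, (tileCA τ)^[t] v p ∈ solid T
    · refine Filter.Eventually.of_forall fun t _ => ?_
      rw [limitConfig, if_pos h]
      exact h 0
    · push Not at h
      obtain ⟨t₀, h⟩ := h
      filter_upwards [Filter.eventually_ge_atTop t₀] with t ht h'
      obtain ⟨s, rfl⟩ := Nat.exists_eq_add_of_le' ht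
      rw [Function.iterate_add_apply] at h'
      exact absurd (solid_of_iterate_solid (x := p.1) (y := p.2) h').1 h
  obtain ⟨t₀, h⟩ := Filter.eventually_atTop.1 key
  refine ⟨t₀, fun t ht p => ⟨fun hp => h t ht p ?_ hp, fun hp => limitConfig_of_solid hp t ▸ hp⟩⟩
  have := abs_le_of_solid (x := p.1) (y := p.2) hB (solid_of_iterate_solid hp).1
  simp only [abs_le] at this
  exact ⟨this.1, this.2⟩

/-- Nothing moves to the east. -/
theorem iterate_eq_O_of_lt (hB : ∀ x y, B < x → v (x, y) = .O) (t : ℕ) {x y : ℤ} (h : B < x) :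
    (tileCA τ)^[t] v (x, y) = .O := by
  induction t generalizing x y with
  | zero => exact hB x y h
  | succ t ih =>
    rw [Function.iterate_succ_apply']
    refine tileCA_eq_O ?_ (fun hu => ?_) fun hd => ?_
    · rw [ih h]
      exact O_notMem_solid
    · rcases hu.cases with ⟨-, ⟨h1, -⟩ | ⟨h1, -⟩ | ⟨h1, -⟩⟩ <;> rw [ih (by omega)] at h1 <;> cases h1
    · rcases hd.cases with ⟨-, ⟨h1, -⟩ | ⟨h1, -⟩ | ⟨h1, -⟩⟩ <;> rw [ih (by omega)] at h1 <;> cases h1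

theorem exists_forall_ne_U_D (hB : ∀ x y, v (x, y) ≠ .O → |x| ≤ B ∧ |y| ≤ B) (m : ℤ) :
    ∃ t₁, ∀ t, t₁ ≤ t → ∀ x y, m ≤ x →
      (tileCA τ)^[t] v (x, y) ≠ .U ∧ (tileCA τ)^[t] v (x, y) ≠ .D := by
  obtain ⟨t₀, ht₀⟩ := exists_solid_iff (τ := τ) hB
  have hO : ∀ t x y, B < x → (tileCA τ)^[t] v (x, y) = .O := fun t x y hx =>
    iterate_eq_O_of_lt (fun x y hx => by
      by_contra h
      have := (abs_le.1 (hB x y h).1).2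
      omega) t hx
  have hz : ∀ x y, limitConfig τ v (x, y) ∈ solid T → |y| ≤ B := fun x y h =>
    (abs_le_of_solid hB (limitConfig_of_solid h 0 ▸ h)).2
  obtain ⟨t₁, ht₁⟩ := exists_forall_not_of_step (B := B) (t₀ := t₀)
    (a := fun t x y => (tileCA τ)^[t] v (x, y) = .U)
    (s := fun x y => limitConfig τ v (x, y) ∈ solid T) hz
    (fun t x y hx h => by rw [hO t x y hx] at h; cases h)
    (fun t ht x y h => by
      rw [Function.iterate_succ_apply'] at h
      simp only [← ht₀ t ht]
      rcases (upAt_of_tileCA_eq_U h).cases with ⟨-, h1 | ⟨h1, -⟩ | ⟨h1, h2, -, h4⟩⟩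
      · exact .inl h1
      · exact .inr (.inl h1)
      · exact .inr (.inr ⟨h1, by rw [h2]; exact O_notMem_solid, h4⟩))
    (B - m + 1).toNat
  -- A `D` obeys the mirrored rules, so the argument for `U` applies after `y ↦ -y`.
  obtain ⟨t₂, ht₂⟩ := exists_forall_not_of_step (B := B) (t₀ := t₀)
    (a := fun t x y => (tileCA τ)^[t] v (x, -y) = .D)
    (s := fun x y => limitConfig τ v (x, -y) ∈ solid T) (fun x y h => abs_neg y ▸ hz x (-y) h)
    (fun t x y hx h => by rw [hO t x _ hx] at h; cases h)
    (fun t ht x y h => by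
      rw [Function.iterate_succ_apply'] at h
      simp only [← ht₀ t ht, show -(y - 1) = -y + 1 by ring, show -(y + 1) = -y - 1 by ring]
      rcases (downAt_of_tileCA_eq_D h).cases with ⟨-, h1 | ⟨h1, -⟩ | ⟨h1, h2, -, h4⟩⟩
      · exact .inl h1
      · exact .inr (.inl h1)
      · exact .inr (.inr ⟨h1, by rw [h2]; exact O_notMem_solid, h4⟩))
    (B - m + 1).toNat
  refine ⟨max t₁ t₂, fun t ht x y hx => ⟨ht₁ t (by omega) x y (by omega), fun h => ?_⟩⟩
  exact ht₂ t (by omega) x (-y) (by omega) (by rwa [neg_neg])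

theorem exists_eq_limitConfig (hB : ∀ x y, v (x, y) ≠ .O → |x| ≤ B ∧ |y| ≤ B) (m : ℤ) :
    ∃ t₁, ∀ t, t₁ ≤ t → ∀ x y, m ≤ x →
      (tileCA τ)^[t] v (x, y) = limitConfig τ v (x, y) := by
  obtain ⟨t₀, ht₀⟩ := exists_solid_iff (τ := τ) hB
  obtain ⟨t₁, ht₁⟩ := exists_forall_ne_U_D (τ := τ) hB m
  refine ⟨max t₀ t₁, fun t ht x y hx => ?_⟩
  by_cases h : limitConfig τ v (x, y) ∈ solid T
  · exact limitConfig_of_solid h t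
  · rw [limitConfig_eq_O h]
    have h1 := ht₁ t (by omega) x y hx
    rw [← ht₀ t (by omega)] at h
    rcases eq_U_or_D_or_O h with h | h | h
    · exact absurd h h1.1
    · exact absurd h h1.2
    · exact h

/-- Once the set of solid cells is final, a solid cell that survives another step certifies the
patterns around it. The limit differs from the configuration at that time only by liquid states. -/
theorem admissible_limitConfig (hB : ∀ x y, v (x, y) ≠ .O → |x| ≤ B ∧ |y| ≤ B) :
    Admissible τ (limitConfig τ v) := by
  obtain ⟨t₀, ht₀⟩ := exists_solid_iff (τ := τ) hB
  intro x y
  by_cases h : ∀ i j, window (limitConfig τ v) x y i j ∈ liquid T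
  · exact allowed_of_liquid h
  push Not at h
  obtain ⟨i, j, h⟩ := h
  rw [← notMem_solid_iff, not_not] at h
  change limitConfig τ v (x + ((j : ℕ) : ℤ) - 1, y + 1 - ((i : ℕ) : ℤ)) ∈ solid T at h
  have h1 := limitConfig_of_solid h (t₀ + 1)
  rw [Function.iterate_succ_apply'] at h1
  have h2 := (of_tileCA_solid (h1.symm ▸ h)).1 x y
    (abs_le.2 (by have := j.2; omega)) (abs_le.2 (by have := i.2; omega))
  refine h2.congr fun i j => ?_
  by_cases h : window (limitConfig τ v) x y i j ∈ solid T
  · exact .inl (limitConfig_of_solid h t₀).symm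
  · refine .inr ⟨notMem_solid_iff.1 h, notMem_solid_iff.1 fun h' => h ?_⟩
    exact (ht₀ t₀ le_rfl _).1 h'

end TileCA

/-! ### One step of a pair of particles, and the symmetry between `U` and `D`. -/

namespace TileCA
variable {T : Type u} {τ : TileSet T}

/-! ### Pairs of particles -/

/-- Puts a `U` on `p` and a `D` on `q`. -/
def insertPair (w : Config (State T)) (p q : ℤ × ℤ) : Config (State T) :=
  fun r => if r = p then .U else if r = q then .D else w r

/-- No particles. -/
def Clean (z : Config (State T)) : Prop := ∀ x y, z (x, y) ∉ solid T → z (x, y) = .O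

theorem insertPair_left (w : Config (State T)) (p q : ℤ × ℤ) : insertPair w p q p = .U :=
  if_pos rfl

theorem insertPair_right (w : Config (State T)) {p q : ℤ × ℤ} (h : p ≠ q) :
    insertPair w p q q = .D := by
  rw [insertPair, if_neg h.symm, if_pos rfl]

theorem insertPair_of_ne (w : Config (State T)) {p q r : ℤ × ℤ} (h : r ≠ p) (h' : r ≠ q) :
    insertPair w p q r = w r := by
  rw [insertPair, if_neg h, if_neg h']

theorem Clean.ne_U {z : Config (State T)} (h : Clean z) (x y : ℤ) : z (x, y) ≠ .U := fun h' => by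
  have := h x y (h' ▸ U_notMem_solid)
  rw [h'] at this
  cases this

theorem Clean.ne_D {z : Config (State T)} (h : Clean z) (x y : ℤ) : z (x, y) ≠ .D := fun h' => by
  have := h x y (h' ▸ D_notMem_solid)
  rw [h'] at this
  cases this

/-- A pair moves as its neighbourhood says, if the configuration is clean near it. -/
theorem tileCA_insertPair {z w : Config (State T)} {m a b c d a' b' c' d' : ℤ}
    (hz : Admissible τ z) (hc : Clean z) (hw : ∀ x y, m ≤ x → w (x, y) = z (x, y))
    (hw' : ∀ x y, m ≤ x → tileCA τ w (x, y) = z (x, y)) (ha : m + 10 ≤ a) (hca : m + 10 ≤ c)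
    (ha' : m + 5 ≤ a') (hca' : m + 5 ≤ c')
    (hp : z (a, b) ∉ solid T) (hq : z (c, d) ∉ solid T)
    (hu : UpAt (insertPair w (a, b) (c, d)) a' b')
    (hd : DownAt (insertPair w (a, b) (c, d)) c' d') (hne : ¬ (a' = c' ∧ b' = d')) :
    tileCA τ (insertPair w (a, b) (c, d)) = insertPair (tileCA τ w) (a', b') (c', d') := by
  set v := insertPair w (a, b) (c, d) with hv
  have hvw : ∀ x y, ¬ (x = a ∧ y = b) → ¬ (x = c ∧ y = d) → v (x, y) = w (x, y) :=
    fun x y h1 h2 => insertPair_of_ne w (by simpa using h1) (by simpa using h2)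
  have hU : ∀ x y, m ≤ x → v (x, y) = .U → x = a ∧ y = b := by
    intro x y hx h
    by_contra h1
    by_cases h2 : x = c ∧ y = d
    · obtain ⟨rfl, rfl⟩ := h2
      rw [hv, insertPair, if_neg (by simpa using h1), if_pos rfl] at h
      cases h
    · rw [hvw x y h1 h2, hw x y hx] at h
      exact hc.ne_U x y h
  have hD : ∀ x y, m ≤ x → v (x, y) = .D → x = c ∧ y = d := by
    intro x y hx h
    by_contra h2
    by_cases h1 : x = a ∧ y = b
    · obtain ⟨rfl, rfl⟩ := h1
      rw [hv, insertPair, if_pos rfl] at h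
      cases h
    · rw [hvw x y h1 h2, hw x y hx] at h
      exact hc.ne_D x y h
  have near : ∀ {x m : ℤ} {p k : ℤ}, |p - x| + k ≤ 1 → 0 ≤ k → m + 1 ≤ x → m ≤ p := by
    intro x m p k h1 h2 h3
    have := abs_le.1 (show |p - x| ≤ 1 by omega)
    omega
  have uu : ∀ x y, m + 5 ≤ x → UpAt v x y → x = a' ∧ y = b' := fun x y hx h =>
    h.unique hu (fun p q h1 h2 => hU p q (near h1 (abs_nonneg _) (by omega)) h2)
      fun p q h1 h2 => hU p q (near h1 (abs_nonneg _) (by omega)) h2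
  have dd : ∀ x y, m + 5 ≤ x → DownAt v x y → x = c' ∧ y = d' := fun x y hx h =>
    h.unique hd (fun p q h1 h2 => hD p q (near h1 (abs_nonneg _) (by omega)) h2)
      fun p q h1 h2 => hD p q (near h1 (abs_nonneg _) (by omega)) h2
  have hpa : |a' - a| ≤ 1 ∧ |b' - b| ≤ 1 := by
    simp only [abs_le]
    rcases hu.cases with ⟨-, ⟨h1, -⟩ | ⟨h1, -⟩ | ⟨h1, -⟩⟩ <;>
      have := hU _ _ (by omega) h1 <;> omega
  have hpc : |c' - c| ≤ 1 ∧ |d' - d| ≤ 1 := by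
    simp only [abs_le]
    rcases hd.cases with ⟨-, ⟨h1, -⟩ | ⟨h1, -⟩ | ⟨h1, -⟩⟩ <;>
      have := hD _ _ (by omega) h1 <;> omega
  simp only [abs_le] at hpa hpc
  funext ⟨x, y⟩
  -- A cell that sees neither particle behaves as without the pair. Near a particle, `w` agrees with
  -- the clean `z`, so all patterns are allowed and the particle has just one target. The margins in
  -- `m` keep these neighbourhoods away from the western columns, where `w` is arbitrary.
  by_cases hfar : (|x - a| ≤ 2 ∧ |y - b| ≤ 2) ∨ (|x - c| ≤ 2 ∧ |y - d| ≤ 2)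
  · simp only [abs_le] at hfar
    have hok : OkAt τ v x y := by
      intro x' y' hx hy
      rw [abs_le] at hx hy
      refine (hz x' y').congr fun i j => ?_
      have hcell : ∀ x y, m ≤ x → v (x, y) = z (x, y) ∨ v (x, y) ∈ liquid T ∧ z (x, y) ∈ liquid T := by
        intro x y hx
        by_cases h1 : x = a ∧ y = b
        · obtain ⟨rfl, rfl⟩ := h1
          refine .inr ⟨?_, notMem_solid_iff.1 hp⟩
          rw [hv, insertPair_left, mem_liquid_iff, kind_U]
        by_cases h2 : x = c ∧ y = d
        · obtain ⟨rfl, rfl⟩ := h2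
          refine .inr ⟨?_, notMem_solid_iff.1 hq⟩
          rw [hv, insertPair_right w (by simpa [eq_comm] using h1), mem_liquid_iff, kind_D]
        · exact .inl (by rw [hvw x y h1 h2, hw x y hx])
      exact hcell _ _ (by omega)
    have hx : m + 8 ≤ x := by omega
    by_cases hs : z (x, y) ∈ solid T
    · have h1 : ¬ (x = a ∧ y = b) := by rintro ⟨rfl, rfl⟩; exact hp hs
      have h2 : ¬ (x = c ∧ y = d) := by rintro ⟨rfl, rfl⟩; exact hq hs
      have hvz : v (x, y) = z (x, y) := by rw [hvw x y h1 h2, hw x y (by omega)]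
      rw [tileCA_of_solid hok (hvz ▸ hs), insertPair_of_ne, hvz, hw' x y (by omega)]
      · rintro ⟨⟩
        exact O_notMem_solid (hu.cases.1 ▸ hvz ▸ hs)
      · rintro ⟨⟩
        exact O_notMem_solid (hd.cases.1 ▸ hvz ▸ hs)
    · have hvs : v (x, y) ∉ solid T := by
        by_cases h1 : x = a ∧ y = b
        · obtain ⟨rfl, rfl⟩ := h1
          rw [hv, insertPair_left]
          exact U_notMem_solid
        by_cases h2 : x = c ∧ y = d
        · obtain ⟨rfl, rfl⟩ := h2
          rw [hv, insertPair_right w (by simpa [eq_comm] using h1)]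
          exact D_notMem_solid
        · rwa [hvw x y h1 h2, hw x y (by omega)]
      by_cases h1 : x = a' ∧ y = b'
      · obtain ⟨rfl, rfl⟩ := h1
        rw [tileCA_eq_U hok hu, insertPair_left]
      have hnu : ¬ UpAt v x y := fun h => h1 (uu x y (by omega) h)
      by_cases h2 : x = c' ∧ y = d'
      · obtain ⟨rfl, rfl⟩ := h2
        rw [tileCA_eq_D hok hd hnu, insertPair_right _ (by simpa [eq_comm] using h1)]
      rw [tileCA_eq_O hvs hnu fun h => h2 (dd x y (by omega) h),
        insertPair_of_ne _ (by simpa using h1) (by simpa using h2), hw' x y (by omega), hc x y hs]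
  · rw [insertPair_of_ne]
    · refine tileCA_congr fun x' y' hx hy => hvw x' y' ?_ ?_
      · rintro ⟨rfl, rfl⟩
        exact hfar (.inl ⟨abs_sub_comm x' x ▸ hx, abs_sub_comm y' y ▸ hy⟩)
      · rintro ⟨rfl, rfl⟩
        exact hfar (.inr ⟨abs_sub_comm x' x ▸ hx, abs_sub_comm y' y ▸ hy⟩)
    · rintro ⟨⟩
      exact hfar (.inl ⟨abs_le.2 (by omega), abs_le.2 (by omega)⟩)
    · rintro ⟨⟩
      exact hfar (.inr ⟨abs_le.2 (by omega), abs_le.2 (by omega)⟩)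

/-! ### The vertical reflection -/

/-- Exchanges `U` and `D`. -/
def swapUD : State T → State T
  | .U => .D
  | .D => .U
  | s => s

/-- The reflection of a configuration in the horizontal axis, with `U` and `D` exchanged. -/
def flip (v : Config (State T)) : Config (State T) := fun p => swapUD (v (p.1, -p.2))

@[simp] theorem swapUD_eq_O {s : State T} : swapUD s = .O ↔ s = .O := by cases s <;> simp [swapUD]
@[simp] theorem swapUD_eq_U {s : State T} : swapUD s = .U ↔ s = .D := by cases s <;> simp [swapUD]
@[simp] theorem swapUD_eq_D {s : State T} : swapUD s = .D ↔ s = .U := by cases s <;> simp [swapUD]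
@[simp] theorem swapUD_mem_solid {s : State T} : swapUD s ∈ solid T ↔ s ∈ solid T := by
  cases s <;> simp [swapUD, mem_solid_iff]

/-- Turning the tables for `U` upside down and exchanging the letters gives the tables for `D` in
the same order. Motion of a `D` round an obstacle thus follows from that of a `U`. -/
theorem downAt_of_upAt_flip {v : Config (State T)} {x y : ℤ} (h : UpAt (flip v) x (-y)) :
    DownAt v x y := by
  obtain ⟨M, hM, hm⟩ := h
  simp only [upTables, Set.mem_insert_iff, Set.mem_singleton_iff] at hM
  have e1 : -(-y + 1) = y - 1 := by ring
  have e2 : -(-y - 1) = y + 1 := by ring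
  simp only [DownAt, downTables, Set.mem_insert_iff, Set.mem_singleton_iff, exists_eq_or_imp,
    exists_eq_left, matches_window_iff]
  rcases hM with rfl | rfl | rfl | rfl | rfl | rfl | rfl <;>
    rw [matches_window_iff] at hm <;>
    simp only [flip, e1, e2, neg_neg, Set.mem_singleton_iff, Set.mem_union, swapUD_eq_O,
      swapUD_eq_U, swapUD_eq_D, swapUD_mem_solid] at hm ⊢ <;>
    obtain ⟨h1, h2, h3⟩ := hm
  · exact .inl ⟨h3, h2, h1⟩
  · exact .inr (.inl ⟨h3, h2, h1⟩)
  · exact .inr (.inr (.inl ⟨h3, h2, h1⟩))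
  · exact .inr (.inr (.inr (.inl ⟨h3, h2, h1⟩)))
  · exact .inr (.inr (.inr (.inr (.inl ⟨h3, h2, h1⟩))))
  · exact .inr (.inr (.inr (.inr (.inr (.inl ⟨h3, h2, h1⟩)))))
  · exact .inr (.inr (.inr (.inr (.inr (.inr ⟨h3, h2, h1⟩)))))

end TileCA

namespace TileCA
variable {T : Type u} {τ : TileSet T}

/-! ### Going round an obstacle -/

/-- `(x, y)` is the cell reached after `a` steps on the counterclockwise way of a `U` round the
obstacle with columns `xl..xr` and rows `yb..yt`, from the lowest cell on the east side. -/
def OnLoop (xl xr yb yt a x y : ℤ) : Prop :=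
  a ≤ yt + 1 - yb ∧ x = xr + 1 ∧ y = yb + a ∨
  yt + 1 - yb < a ∧ a ≤ yt + 3 - yb + xr - xl ∧ x = xr + 1 - (a - (yt + 1 - yb)) ∧ y = yt + 1 ∨
  yt + 3 - yb + xr - xl < a ∧ x = xl - 1 ∧ y = yt + 1 - (a - (yt + 3 - yb + xr - xl))

theorem exists_onLoop (xl xr yb yt a : ℤ) : ∃ x y, OnLoop xl xr yb yt a x y := by
  by_cases h1 : a ≤ yt + 1 - yb
  · exact ⟨_, _, .inl ⟨h1, rfl, rfl⟩⟩
  by_cases h2 : a ≤ yt + 3 - yb + xr - xl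
  · exact ⟨_, _, .inr (.inl ⟨by omega, h2, rfl, rfl⟩)⟩
  · exact ⟨_, _, .inr (.inr ⟨by omega, rfl, rfl⟩)⟩

/-- Here `a` and `b` count the steps of the two particles on mirror-image ways. Their difference is
constant during the passage. Their sum starts at the height of the obstacle, when the particles are
adjacent on the east side, and the upper bound stops just before they meet again. The four
inequalities keep each particle away from the other except in the configurations provided for by the
tables. -/
theorem upAt_of_onLoop {v : Config (State T)} {xl xr yb yt px py qx qy a b x y : ℤ}
    (hw : xl + 3 ≤ xr) (hh : yb + 3 ≤ yt)
    (hS : ∀ x y, xl ≤ x → x ≤ xr → yb ≤ y → y ≤ yt → v (x, y) ∈ solid T)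
    (hO : ∀ x y, xl - 2 ≤ x → x ≤ xr + 2 → yb - 2 ≤ y → y ≤ yt + 2 →
      (x < xl ∨ xr < x ∨ y < yb ∨ yt < y) → ¬ (x = px ∧ y = py) → ¬ (x = qx ∧ y = qy) →
      v (x, y) = .O)
    (hp : v (px, py) = .U) (hq : v (qx, qy) = .D)
    (hab : yt + 1 - yb ≤ a + b) (hab' : a + b ≤ 3 * (yt + 1 - yb) + 2 * (xr + 1 - xl))
    (hba : a - b ≤ yt + 1 - yb) (hba' : b - a ≤ yt + 1 - yb)
    (hpa : OnLoop xl xr yb yt a px py) (hqb : OnLoop xl xr (-yt) (-yb) b qx (-qy))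
    (hxy : OnLoop xl xr yb yt (a + 1) x y) : UpAt v x y := by
  unfold OnLoop at hpa hqb hxy
  have hQ : ∀ x y, xl - 2 ≤ x → x ≤ xr + 2 → yb - 2 ≤ y → y ≤ yt + 2 → ¬ (x = px ∧ y = py) →
      ¬ (x = qx ∧ y = qy) → v (x, y) ∈ ({State.O} ∪ solid T : Set (State T)) := by
    intro x y h1 h2 h3 h4 h5 h6
    by_cases h7 : x < xl ∨ xr < x ∨ y < yb ∨ yt < y
    · exact .inl (hO x y h1 h2 h3 h4 h7 h5 h6)
    · exact .inr (hS x y (by omega) (by omega) (by omega) (by omega))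
  simp only [UpAt, upTables, Set.mem_insert_iff, Set.mem_singleton_iff, exists_eq_or_imp,
    exists_eq_left, matches_window_iff]
  rcases hxy with ⟨h1, rfl, rfl⟩ | ⟨h1, h2, rfl, rfl⟩ | ⟨h1, rfl, rfl⟩
  · obtain ⟨rfl, rfl⟩ : px = xr + 1 ∧ py = yb + a := by omega
    have hN : v (xr + 1, yb + (a + 1) - 1) = .U := by rwa [show yb + (a + 1) - 1 = yb + a by ring]
    by_cases h2 : a + 1 = yt + 1 - yb
    · refine .inr (.inl ⟨⟨?_, ?_, ?_⟩, ⟨?_, ?_, ?_⟩, ?_, hN, ?_⟩)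
      on_goal 7 => exact hS _ _ (by omega) (by omega) (by omega) (by omega)
      all_goals
        exact hO _ _ (by omega) (by omega) (by omega) (by omega) (by omega) (by omega) (by omega)
    · refine .inl ⟨⟨?_, ?_, ?_⟩, ⟨?_, ?_, ?_⟩, ?_, hN, ?_⟩
      on_goal 1 => exact hQ _ _ (by omega) (by omega) (by omega) (by omega) (by omega) (by omega)
      on_goal 3 => exact hS _ _ (by omega) (by omega) (by omega) (by omega)
      on_goal 5 => exact hS _ _ (by omega) (by omega) (by omega) (by omega)
      all_goals
        exact hO _ _ (by omega) (by omega) (by omega) (by omega) (by omega) (by omega) (by omega)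
  · obtain ⟨x, hx⟩ : ∃ x, x = xr + 1 - (a + 1 - (yt + 1 - yb)) := ⟨_, rfl⟩
    rw [← hx]
    obtain ⟨rfl, rfl⟩ : px = x + 1 ∧ py = yt + 1 := by omega
    by_cases h3 : x ≤ xl
    · refine .inr (.inr (.inr (.inl ⟨⟨?_, ?_, ?_⟩, ⟨?_, ?_, hp⟩, ?_, ?_, ?_⟩)))
      on_goal 7 => exact hQ _ _ (by omega) (by omega) (by omega) (by omega) (by omega) (by omega)
      on_goal 7 => exact hS _ _ (by omega) (by omega) (by omega) (by omega)
      all_goals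
        exact hO _ _ (by omega) (by omega) (by omega) (by omega) (by omega) (by omega) (by omega)
    · refine .inr (.inr (.inl ⟨⟨?_, ?_, ?_⟩, ⟨?_, ?_, hp⟩, ?_, ?_, ?_⟩))
      on_goal 6 => exact hS _ _ (by omega) (by omega) (by omega) (by omega)
      on_goal 6 => exact hS _ _ (by omega) (by omega) (by omega) (by omega)
      -- This cell can hold the `D` only if the pair has hit the top row: then `U` is at the
      -- north-east corner and `D` directly below it.
      on_goal 6 =>
        by_cases h4 : x + 1 = qx ∧ yt + 1 - 1 = qy
        · rw [h4.1, h4.2]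
          exact .inr hq
        · exact .inl (hQ _ _ (by omega) (by omega) (by omega) (by omega) (by omega) h4)
      all_goals
        exact hO _ _ (by omega) (by omega) (by omega) (by omega) (by omega) (by omega) (by omega)
  · obtain ⟨y, hy⟩ : ∃ y, y = yt + 1 - (a + 1 - (yt + 3 - yb + xr - xl)) := ⟨_, rfl⟩
    rw [← hy]
    obtain ⟨rfl, rfl⟩ : px = xl - 1 ∧ py = y + 1 := by omega
    by_cases h3 : y = yb
    -- When `U` is about to reach the bottom row, both the sum and the difference bound are
    -- attained, so `D` is one step before the south-west corner.
    · obtain ⟨rfl, rfl⟩ : qx = xl - 1 + 1 ∧ qy = y - 1 := by omega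
      refine .inr (.inr (.inr (.inr (.inr (.inl ⟨⟨?_, hp, ?_⟩, ⟨?_, ?_, ?_⟩, ?_, ?_, hq⟩)))))
      on_goal 2 => exact hS _ _ (by omega) (by omega) (by omega) (by omega)
      on_goal 4 => exact hS _ _ (by omega) (by omega) (by omega) (by omega)
      all_goals
        exact hO _ _ (by omega) (by omega) (by omega) (by omega) (by omega) (by omega) (by omega)
    · refine .inr (.inr (.inr (.inr (.inl ⟨⟨?_, hp, ?_⟩, ⟨?_, ?_, ?_⟩, ?_, ?_, ?_⟩))))
      on_goal 2 => exact hQ _ _ (by omega) (by omega) (by omega) (by omega) (by omega) (by omega)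
      on_goal 4 => exact hS _ _ (by omega) (by omega) (by omega) (by omega)
      on_goal 6 => exact hS _ _ (by omega) (by omega) (by omega) (by omega)
      all_goals
        exact hO _ _ (by omega) (by omega) (by omega) (by omega) (by omega) (by omega) (by omega)

theorem downAt_of_onLoop {v : Config (State T)} {xl xr yb yt px py qx qy a b x y : ℤ}
    (hw : xl + 3 ≤ xr) (hh : yb + 3 ≤ yt)
    (hS : ∀ x y, xl ≤ x → x ≤ xr → yb ≤ y → y ≤ yt → v (x, y) ∈ solid T)
    (hO : ∀ x y, xl - 2 ≤ x → x ≤ xr + 2 → yb - 2 ≤ y → y ≤ yt + 2 →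
      (x < xl ∨ xr < x ∨ y < yb ∨ yt < y) → ¬ (x = px ∧ y = py) → ¬ (x = qx ∧ y = qy) →
      v (x, y) = .O)
    (hp : v (px, py) = .U) (hq : v (qx, qy) = .D)
    (hab : yt + 1 - yb ≤ a + b) (hab' : a + b ≤ 3 * (yt + 1 - yb) + 2 * (xr + 1 - xl))
    (hba : a - b ≤ yt + 1 - yb) (hba' : b - a ≤ yt + 1 - yb)
    (hpa : OnLoop xl xr yb yt a px py) (hqb : OnLoop xl xr (-yt) (-yb) b qx (-qy))
    (hxy : OnLoop xl xr (-yt) (-yb) (b + 1) x (-y)) : DownAt v x y := by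
  refine downAt_of_upAt_flip (upAt_of_onLoop (px := qx) (py := -qy) (qx := px) (qy := -py)
    (a := b) (b := a) hw (by omega) (fun x y h1 h2 h3 h4 => ?_) (fun x y h1 h2 h3 h4 h5 h6 h7 => ?_)
    ?_ ?_ (by omega) (by omega) (by omega) (by omega) hqb (by simpa using hpa) hxy)
  · exact swapUD_mem_solid.2 (hS x (-y) h1 h2 (by omega) (by omega))
  · exact swapUD_eq_O.2 (hO x (-y) h1 h2 (by omega) (by omega) (by omega) (by omega) (by omega))
  · simpa [flip] using hq
  · simpa [flip] using hp

end TileCA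

/-! ### Transport of pairs through a field of obstacles. -/

namespace TileCA
variable {T : Type u} {τ : TileSet T}

/-! ### Paths of pairs -/

/-- Puts a `U` on `(x, y + 1)` and a `D` on `(x, y)`. -/
def pairAt (w : Config (State T)) (x y : ℤ) : Config (State T) := insertPair w (x, y + 1) (x, y)

/-- In the columns from `m` on, `w` is and remains equal to `z`. -/
def StaysEqual (τ : TileSet T) (z : Config (State T)) (m : ℤ) (w : Config (State T)) : Prop :=
  ∀ t x y, m ≤ x → (tileCA τ)^[t] w (x, y) = z (x, y)

theorem StaysEqual.iterate {z w : Config (State T)} {m : ℤ} (h : StaysEqual τ z m w) (s : ℕ) :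
    StaysEqual τ z m ((tileCA τ)^[s] w) := fun t x y hx => by
  rw [← Function.iterate_add_apply]
  exact h _ x y hx

variable {z w : Config (State T)} {m : ℤ}

/-- The last tables for `U` and `D` let each particle move west because of the other, whatever clean
surroundings there are. -/
theorem tileCA_pairAt (hz : Admissible τ z) (hc : Clean z) (hw : StaysEqual τ z m w) {x y : ℤ}
    (hx : m + 11 ≤ x) (h1 : z (x + 1, y + 1) ∉ solid T) (h2 : z (x + 1, y) ∉ solid T)
    (h3 : z (x, y + 1) ∉ solid T) (h4 : z (x, y) ∉ solid T) :
    tileCA τ (pairAt w (x + 1) y) = pairAt (tileCA τ w) x y := by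
  have hQ : ∀ x' y', m ≤ x' → ¬ (x' = x + 1 ∧ y' = y + 1) → ¬ (x' = x + 1 ∧ y' = y) →
      pairAt w (x + 1) y (x', y') ∈ ({State.O} ∪ solid T : Set (State T)) := by
    intro x' y' hx h1 h2
    rw [pairAt, insertPair_of_ne w (by simpa using h1) (by simpa using h2)]
    have hwz : w (x', y') = z (x', y') := hw 0 x' y' hx
    rw [hwz]
    by_cases h : z (x', y') ∈ solid T
    · exact .inr h
    · exact .inl (hc x' y' h)
  have hO : ∀ y', y' = y ∨ y' = y + 1 → pairAt w (x + 1) y (x, y') = .O := by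
    intro y' h
    rw [pairAt, insertPair_of_ne w (by simp) (by simp)]
    have hwz : w (x, y') = z (x, y') := hw 0 x y' (by omega)
    rw [hwz]
    rcases h with rfl | rfl
    · exact hc _ _ h4
    · exact hc _ _ h3
  have hU : pairAt w (x + 1) y (x + 1, y + 1) = .U := insertPair_left w _ _
  have hD : pairAt w (x + 1) y (x + 1, y) = .D := insertPair_right w (by simp)
  refine tileCA_insertPair hz hc (fun x y h => hw 0 x y h) (fun x y h => hw 1 x y h) (by omega)
    (by omega) (by omega) (by omega) h1 h2 ?_ ?_ (by omega)
  · simp only [UpAt, upTables, Set.mem_insert_iff, Set.mem_singleton_iff, exists_eq_or_imp,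
      exists_eq_left, matches_window_iff]
    refine .inr (.inr (.inr (.inr (.inr (.inr ⟨⟨?_, ?_, ?_⟩, ⟨?_, hO _ (.inr rfl), hU⟩, ?_, ?_, ?_⟩)))))
    on_goal 7 =>
      rw [add_sub_cancel_right]
      exact hD
    all_goals exact hQ _ _ (by omega) (by omega) (by omega)
  · simp only [DownAt, downTables, Set.mem_insert_iff, Set.mem_singleton_iff, exists_eq_or_imp,
      exists_eq_left, matches_window_iff]
    refine .inr (.inr (.inr (.inr (.inr (.inr ⟨⟨?_, ?_, hU⟩, ⟨?_, hO _ (.inl rfl), hD⟩, ?_, ?_, ?_⟩)))))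
    all_goals exact hQ _ _ (by omega) (by omega) (by omega)

theorem IsObstacle.notMem_solid {xl xr yb yt : ℤ} (h : IsObstacle z xl xr yb yt) {x y : ℤ}
    (h1 : xl - 2 ≤ x) (h2 : x ≤ xr + 2) (h3 : yb - 2 ≤ y) (h4 : y ≤ yt + 2)
    (h5 : x < xl ∨ xr < x ∨ y < yb ∨ yt < y) : z (x, y) ∉ TileCA.solid T := by
  rw [mem_solid_iff, not_not]
  exact h.ring x y h1 h2 h3 h4 h5

/-- A pair that hits an obstacle goes round it and appears on the other side. -/
theorem iterate_pairAt_of_isObstacle (hz : Admissible τ z) (hc : Clean z)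
    {xl xr yb yt y : ℤ} (ho : IsObstacle z xl xr yb yt)
    (hm : m + 11 ≤ xl) (hy : yb - 1 ≤ y) (hy' : y ≤ yt) :
    ∃ n, ∀ w, StaysEqual τ z m w → (tileCA τ)^[n] (pairAt w (xr + 1) y) =
      pairAt ((tileCA τ)^[n] w) (xl - 1) (yb + yt - 1 - y) := by
  have hwd := ho.width
  have hht := ho.height
  -- Height plus width plus one: after this many steps `U` has descended on the west side as far as
  -- it had already been above the lowest cell on the east side. This is the reflection of the
  -- height.
  obtain ⟨n, hn⟩ : ∃ n : ℕ, (n : ℤ) = yt + 1 - yb + (xr + 1 - xl) + 1 :=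
    ⟨(yt + 1 - yb + (xr + 1 - xl) + 1).toNat, by omega⟩
  refine ⟨n, fun w hw => ?_⟩
  have key : ∀ k : ℕ, k ≤ n → ∃ px py qx qy, OnLoop xl xr yb yt (y + 1 - yb + k) px py ∧
      OnLoop xl xr (-yt) (-yb) (yt - y + k) qx (-qy) ∧
      (tileCA τ)^[k] (pairAt w (xr + 1) y) = insertPair ((tileCA τ)^[k] w) (px, py) (qx, qy) := by
    intro k hk
    induction k with
    | zero =>
      refine ⟨xr + 1, y + 1, xr + 1, y, .inl ⟨?_, rfl, ?_⟩, .inl ⟨?_, rfl, ?_⟩, rfl⟩ <;>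
        push_cast <;> omega
    | succ k ih =>
      obtain ⟨px, py, qx, qy, hp, hq, e⟩ := ih (by omega)
      obtain ⟨px', py', hp'⟩ := exists_onLoop xl xr yb yt (y + 1 - yb + k + 1)
      obtain ⟨qx', qy', hq'⟩ := exists_onLoop xl xr (-yt) (-yb) (yt - y + k + 1)
      obtain ⟨qy', rfl⟩ : ∃ b, qy' = -b := ⟨-qy', by ring⟩
      refine ⟨px', py', qx', qy', by push_cast; rwa [← add_assoc],
        by push_cast; rwa [← add_assoc], ?_⟩
      rw [Function.iterate_succ_apply', e, Function.iterate_succ_apply']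
      have hwk := hw.iterate k
      have hpr : xl - 1 ≤ px ∧ px ≤ xr + 1 ∧ yb - 1 ≤ py ∧ py ≤ yt + 1 ∧
          (px < xl ∨ xr < px ∨ py < yb ∨ yt < py) := by unfold OnLoop at hp; omega
      have hqr : xl - 1 ≤ qx ∧ qx ≤ xr + 1 ∧ yb - 1 ≤ qy ∧ qy ≤ yt + 1 ∧
          (qx < xl ∨ xr < qx ∨ qy < yb ∨ yt < qy) := by unfold OnLoop at hq; omega
      have hpq : ¬ (qx = px ∧ qy = py) := by unfold OnLoop at hp hq; omega
      have hpz := ho.notMem_solid (x := px) (y := py) (by omega) (by omega) (by omega) (by omega)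
        (by omega)
      have hqz := ho.notMem_solid (x := qx) (y := qy) (by omega) (by omega) (by omega) (by omega)
        (by omega)
      have hcell : ∀ x y, m ≤ x → ¬ (x = px ∧ y = py) → ¬ (x = qx ∧ y = qy) →
          insertPair ((tileCA τ)^[k] w) (px, py) (qx, qy) (x, y) = z (x, y) := by
        intro x y hx h1 h2
        rw [insertPair_of_ne _ (by simpa using h1) (by simpa using h2)]
        exact hw k x y hx
      have hS : ∀ x y, xl ≤ x → x ≤ xr → yb ≤ y → y ≤ yt →
          insertPair ((tileCA τ)^[k] w) (px, py) (qx, qy) (x, y) ∈ solid T := by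
        intro x y h1 h2 h3 h4
        rw [hcell x y (by omega) (by omega) (by omega)]
        exact ho.solid h1 h2 h3 h4
      have hO : ∀ x y, xl - 2 ≤ x → x ≤ xr + 2 → yb - 2 ≤ y → y ≤ yt + 2 →
          (x < xl ∨ xr < x ∨ y < yb ∨ yt < y) → ¬ (x = px ∧ y = py) → ¬ (x = qx ∧ y = qy) →
          insertPair ((tileCA τ)^[k] w) (px, py) (qx, qy) (x, y) = .O := by
        intro x y h1 h2 h3 h4 h5 h6 h7
        rw [hcell x y (by omega) h6 h7]
        exact hc x y (ho.notMem_solid h1 h2 h3 h4 h5)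
      have hU := insertPair_left ((tileCA τ)^[k] w) (px, py) (qx, qy)
      have hD := insertPair_right ((tileCA τ)^[k] w) (p := (px, py)) (q := (qx, qy))
        (by simpa [eq_comm] using hpq)
      refine tileCA_insertPair hz hc (fun x y h => hwk 0 x y h) (fun x y h => hwk 1 x y h)
        (by omega) (by omega) (by unfold OnLoop at hp'; omega) (by unfold OnLoop at hq'; omega)
        hpz hqz (upAt_of_onLoop hwd hht hS hO hU hD ?_ ?_ ?_ ?_ hp hq hp')
        (downAt_of_onLoop hwd hht hS hO hU hD ?_ ?_ ?_ ?_ hp hq hq')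
        (by unfold OnLoop at hp' hq'; omega)
      all_goals omega
  obtain ⟨px, py, qx, qy, hp, hq, e⟩ := key n le_rfl
  refine e.trans ?_
  unfold OnLoop at hp hq
  obtain ⟨rfl, rfl⟩ : px = xl - 1 ∧ py = yb + yt - 1 - y + 1 := by omega
  obtain ⟨rfl, rfl⟩ : qx = xl - 1 ∧ qy = yb + yt - 1 - y := by omega
  rfl

/-- Every pair of liquid cells is reached by a pair coming from far in the east. -/
theorem exists_iterate_pairAt (hz : Admissible τ z) (hc : Clean z) {B : ℤ}
    (hB : ∀ x y, z (x, y) ∈ solid T → |x| ≤ B ∧ |y| ≤ B) (r : ℤ) (n : ℕ) {x y : ℤ}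
    (hn : r - x ≤ n) (hx : m + 11 ≤ x) (h1 : z (x, y + 1) ∉ solid T) (h2 : z (x, y) ∉ solid T) :
    ∃ s x₀ y₀, r ≤ x₀ ∧ ∀ w, StaysEqual τ z m w →
      (tileCA τ)^[s] (pairAt w x₀ y₀) = pairAt ((tileCA τ)^[s] w) x y := by
  induction n generalizing x y with
  | zero => exact ⟨0, x, y, by push_cast at hn; omega, fun w _ => rfl⟩
  | succ n ih =>
    push_cast at hn
    -- Trace the pair backwards. If both cells to the east are liquid, it was there one step before.
    -- Otherwise it stands at the west side of an obstacle and came from the east side at the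
    -- reflected height. Either way its column moves east.
    by_cases h : z (x + 1, y + 1) ∉ solid T ∧ z (x + 1, y) ∉ solid T
    · obtain ⟨s, x₀, y₀, hr, hs⟩ := ih (by omega) (by omega) h.1 h.2
      refine ⟨s + 1, x₀, y₀, hr, fun w hw => ?_⟩
      rw [Function.iterate_succ_apply', Function.iterate_succ_apply', hs w hw]
      exact tileCA_pairAt hz hc (hw.iterate s) hx h.1 h.2 h1 h2
    · obtain ⟨y', hy', hs⟩ : ∃ y', (y' = y ∨ y' = y + 1) ∧ z (x + 1, y') ∈ solid T := by
        by_cases h' : z (x + 1, y) ∈ solid T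
        · exact ⟨y, .inl rfl, h'⟩
        · exact ⟨y + 1, .inr rfl, by tauto⟩
      obtain ⟨xl, xr, yb, yt, ho, k1, k2, k3, k4⟩ := hz.exists_isObstacle hB hs
      have hw := ho.width
      obtain rfl : x = xl - 1 := by
        by_contra hne
        rcases hy' with rfl | rfl
        · exact h2 (ho.solid (by omega) (by omega) k3 k4)
        · exact h1 (ho.solid (by omega) (by omega) k3 k4)
      obtain ⟨s, x₀, y₀, hr, hs⟩ := ih (x := xr + 1) (y := yb + yt - 1 - y) (by omega) (by omega)
        (ho.notMem_solid (by omega) (by omega) (by omega) (by omega) (by omega))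
        (ho.notMem_solid (by omega) (by omega) (by omega) (by omega) (by omega))
      obtain ⟨k, hk⟩ := iterate_pairAt_of_isObstacle hz hc (m := m) (y := yb + yt - 1 - y) ho
        (by omega) (by omega) (by omega)
      refine ⟨k + s, x₀, y₀, hr, fun w hw => ?_⟩
      rw [Function.iterate_add_apply, Function.iterate_add_apply, hs w hw, hk _ (hw.iterate s)]
      congr 1
      ring

theorem admissible_O : Admissible τ (fun _ => .O) := fun _ _ =>
  allowed_of_liquid fun _ _ => mem_liquid_iff.2 rfl

/-- A pair in the liquid to the east of a configuration moves to the west. -/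
theorem iterate_pairAt_of_lt {v : Config (State T)} {B : ℤ} (hv : ∀ x y, B < x → v (x, y) = .O)
    (t : ℕ) {x : ℤ} (hx : B + 12 ≤ x) (y : ℤ) :
    (tileCA τ)^[t] (pairAt v (x + t) y) = pairAt ((tileCA τ)^[t] v) x y := by
  have hw : StaysEqual τ (fun _ => .O) (B + 1) v := fun t x y hx =>
    iterate_eq_O_of_lt hv t (by omega)
  induction t generalizing x with
  | zero => simp
  | succ t ih =>
    have e := ih (x := x + 1) (by omega)
    rw [Function.iterate_succ_apply', show x + ((t + 1 : ℕ) : ℤ) = x + 1 + t by push_cast; ring, e,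
      Function.iterate_succ_apply']
    exact tileCA_pairAt admissible_O (fun _ _ _ => rfl) (hw.iterate t) (by omega)
      O_notMem_solid O_notMem_solid O_notMem_solid O_notMem_solid

/-- Every cell that is liquid in the limit is visited by a particle in the orbit of a configuration
that differs from `v` only in the east. -/
theorem exists_iterate_ne {v : Config (State T)} {B : ℤ}
    (hB : ∀ x y, v (x, y) ≠ .O → |x| ≤ B ∧ |y| ≤ B) {x y : ℤ}
    (h : limitConfig τ v (x, y) ∉ solid T) :
    ∃ v' t, (∀ x y, x ≤ B → v' (x, y) = v (x, y)) ∧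
      (tileCA τ)^[t] v (x, y) ≠ (tileCA τ)^[t] v' (x, y) := by
  have hz := admissible_limitConfig (τ := τ) hB
  have hc : Clean (limitConfig τ v) := fun x y h => limitConfig_eq_O h
  have hzB : ∀ x y, limitConfig τ v (x, y) ∈ solid T → |x| ≤ B ∧ |y| ≤ B := fun x y h =>
    abs_le_of_solid hB (by rwa [← limitConfig_of_solid h 0] at h)
  obtain ⟨y', hy', h1, h2⟩ : ∃ y', (y = y' ∨ y = y' + 1) ∧
      limitConfig τ v (x, y' + 1) ∉ solid T ∧ limitConfig τ v (x, y') ∉ solid T := by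
    -- The cell must belong to a vertical pair of liquid cells. If the cell below is solid, the ring
    -- of width two makes the cell above liquid.
    by_cases hs : limitConfig τ v (x, y - 1) ∈ solid T
    · refine ⟨y, .inl rfl, ?_, h⟩
      obtain ⟨xl, xr, yb, yt, ho, k1, k2, k3, k4⟩ := hz.exists_isObstacle hzB hs
      have hyt : y = yt + 1 := by
        by_contra hne
        exact h (ho.solid k1 k2 (by omega) (by omega))
      exact ho.notMem_solid (by omega) (by omega) (by omega) (by omega) (by omega)
    · exact ⟨y - 1, .inr (by ring), by simpa using h, hs⟩
  obtain ⟨s, x₀, y₀, hx₀, hs⟩ := exists_iterate_pairAt (m := x - 11) hz hc hzB (B + 12)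
    (B + 12 - x).toNat (by omega) (by omega) h1 h2
  obtain ⟨t, ht⟩ := exists_eq_limitConfig (τ := τ) hB (x - 11)
  have hw : StaysEqual τ (limitConfig τ v) (x - 11) ((tileCA τ)^[t] v) := fun t' x y hx => by
    rw [← Function.iterate_add_apply]
    exact ht _ (by omega) x y hx
  have hv : ∀ x y, B < x → v (x, y) = .O := fun x y hx => by
    by_contra h
    have := (abs_le.1 (hB x y h).1).2
    omega
  -- Launching the pair `t` columns further east delays its arrival in column `x₀` until the orbit
  -- of `v` has settled near the obstacles.
  refine ⟨pairAt v (x₀ + t) y₀, s + t, fun x y hx => ?_, ?_⟩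
  · have : x ≠ x₀ + t := by omega
    exact insertPair_of_ne v (by simp [this]) (by simp [this])
  · rw [Function.iterate_add_apply, Function.iterate_add_apply, iterate_pairAt_of_lt hv t hx₀ y₀,
      hs _ hw, hw s x y (by omega), limitConfig_eq_O h]
    rcases hy' with rfl | rfl
    · rw [pairAt, insertPair_right _ (by simp)]
      simp
    · rw [pairAt, insertPair_left]
      simp

end TileCA

/-! ### Correspondence between tiled squares and stable obstacles. -/

namespace TileCA
variable {T : Type u} {τ : TileSet T}

/-! ### Tilings of squares -/

theorem TileSet.TilesSquare.mono {m n : ℕ} (h : τ.TilesSquare n) (hmn : m ≤ n) :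
    τ.TilesSquare m := by
  obtain ⟨t, h1, h2⟩ := h
  exact ⟨fun i j => t (i.castLE hmn) (j.castLE hmn), fun i i' j hi => h1 _ _ _ hi,
    fun i j j' hj => h2 _ _ _ hj⟩

theorem tilesSquare_zero (τ : TileSet T) : τ.TilesSquare 0 :=
  ⟨fun i => i.elim0, fun i => i.elim0, fun i => i.elim0⟩

theorem TileSet.TilesSquare.exists_int {n : ℕ} (h : τ.TilesSquare n) (hn : 0 < n) :
    ∃ t : ℤ → ℤ → T,
      (∀ i j : ℤ, 0 ≤ i → i + 1 < n → 0 ≤ j → j < n → τ.hor (t i j) (t (i + 1) j)) ∧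
      ∀ i j : ℤ, 0 ≤ i → i < n → 0 ≤ j → j + 1 < n → τ.ver (t i j) (t i (j + 1)) := by
  obtain ⟨t, h1, h2⟩ := h
  refine ⟨fun i j => t ⟨i.toNat % n, Nat.mod_lt _ hn⟩ ⟨j.toNat % n, Nat.mod_lt _ hn⟩,
    fun i j _ _ _ _ => h1 _ _ _ ?_, fun i j _ _ _ _ => h2 _ _ _ ?_⟩ <;>
  · simp only
    rw [Nat.mod_eq_of_lt (by omega), Nat.mod_eq_of_lt (by omega)]
    omega

theorem TileSet.TilesPlane.tilesSquare (h : τ.TilesPlane) (n : ℕ) : τ.TilesSquare n := by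
  obtain ⟨t, ht⟩ := h
  refine ⟨fun i j => t ((i : ℕ), (j : ℕ)), fun i i' j hi => ?_, fun i j j' hj => ?_⟩
  · simp only [hi, Nat.cast_add, Nat.cast_one]
    exact (ht _ _).1
  · simp only [hj, Nat.cast_add, Nat.cast_one]
    exact (ht _ _).2

theorem isClosed_setOf_rel {I : Type*} [TopologicalSpace T] [DiscreteTopology T] (p q : I)
    (r : T → T → Prop) : IsClosed {t : I → T | r (t p) (t q)} := by
  have h : Continuous fun t : I → T => (t p, t q) :=
    (continuous_apply p).prodMk (continuous_apply q)
  exact (isClosed_discrete {a : T × T | r a.1 a.2}).preimage h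

/-- Compactness of the space of all maps from the lattice to the finite discrete set of tiles: being
valid on a box is a closed condition, and these conditions are nested. -/
theorem tilesPlane_of_forall_tilesSquare [Finite T] (h : ∀ n, τ.TilesSquare n) :
    τ.TilesPlane := by
  let : TopologicalSpace T := ⊥
  have : DiscreteTopology T := ⟨rfl⟩
  let C : ℕ → Set (ℤ × ℤ → T) := fun n => {t | ∀ x y : ℤ, |x| ≤ n → |y| ≤ n →
    τ.hor (t (x, y)) (t (x + 1, y)) ∧ τ.ver (t (x, y)) (t (x, y + 1))}
  have hclosed : ∀ n, IsClosed (C n) := by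
    intro n
    simp only [C, Set.ofPred_forall]
    exact isClosed_iInter fun x => isClosed_iInter fun y => isClosed_iInter fun _ =>
      isClosed_iInter fun _ => (isClosed_setOf_rel _ _ _).inter (isClosed_setOf_rel _ _ _)
  have hne : ∀ n, (C n).Nonempty := by
    intro n
    obtain ⟨t, h1, h2⟩ := (h (2 * n + 2)).exists_int (by omega)
    refine ⟨fun p => t (p.1 + n) (p.2 + n), fun x y hx hy => ?_⟩
    rw [abs_le] at hx hy
    have e1 := h1 (x + n) (y + n) (by omega) (by push_cast; omega) (by omega) (by push_cast; omega)
    have e2 := h2 (x + n) (y + n) (by omega) (by push_cast; omega) (by omega) (by push_cast; omega)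
    exact ⟨by simpa [add_right_comm] using e1, by simpa [add_right_comm] using e2⟩
  obtain ⟨t, ht⟩ := IsCompact.nonempty_iInter_of_sequence_nonempty_isCompact_isClosed C
    (fun n t ht x y hx hy => ht x y (by push_cast; omega) (by push_cast; omega)) hne
    (hclosed 0).isCompact hclosed
  rw [Set.mem_iInter] at ht
  refine ⟨t, fun x y => ht (max x.natAbs y.natAbs) x y ?_ ?_⟩ <;>
  · rw [Int.abs_eq_natAbs]
    push_cast
    simp

theorem exists_isGreatest_tilesSquare [Finite T] (h : ¬ τ.TilesPlane) :
    ∃ n, IsGreatest {k : ℕ | τ.TilesSquare k} n := by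
  have : ∃ n, ¬ τ.TilesSquare n := by
    by_contra! hall
    exact h (tilesPlane_of_forall_tilesSquare hall)
  obtain ⟨n, hn⟩ := this
  have hb : BddAbove {k : ℕ | τ.TilesSquare k} :=
    ⟨n, fun k hk => by
      by_contra hlt
      exact hn (TileSet.TilesSquare.mono hk (by omega))⟩
  exact ⟨_, Nat.sSup_mem ⟨0, tilesSquare_zero τ⟩ hb, fun k hk => le_csSup hb hk⟩

/-! ### Tilings inside obstacles -/

theorem exists_tile_of_kind {s : State T} (h : kind s = (2, 2)) : ∃ a, s = .tile a := by
  cases s <;> simp [kind] at h ⊢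

theorem segClass_of_mem {a b x : ℤ} (h1 : x ≠ a) (h2 : x ≠ b) : segClass a b x = 2 := by
  rw [segClass, if_neg h1, if_neg h2]

theorem IsObstacle.tilesSquare {z : Config (State T)} (hz : Admissible τ z) {xl xr yb yt : ℤ}
    (h : IsObstacle z xl xr yb yt) {n : ℕ} (hx : n ≤ xr - xl - 1) (hy : n ≤ yt - yb - 1) :
    τ.TilesSquare n := by
  have key : ∀ i j : Fin n, ∃ a, z (xl + 1 + (i : ℕ), yb + 1 + (j : ℕ)) = .tile a := fun i j => by
    have := i.2
    have := j.2
    apply exists_tile_of_kind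
    rw [h.kind_eq _ _ (by omega) (by omega) (by omega) (by omega),
      segClass_of_mem (by omega) (by omega), segClass_of_mem (by omega) (by omega)]
  choose t ht using key
  refine ⟨t, fun i i' j hi => ?_, fun i j j' hj => ?_⟩
  · refine (hz (xl + 1 + (i : ℕ)) (yb + 1 + (j : ℕ))).2.1 1 1 2 rfl _ _ ?_ ?_
    · rw [← ht, window_center]
    · rw [← ht, hi, window_eq, Nat.cast_add, ← add_assoc]
      rfl
  · refine (hz (xl + 1 + (i : ℕ)) (yb + 1 + (j : ℕ))).2.2 0 1 1 rfl _ _ ?_ ?_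
    · rw [← ht, hj, window_eq, Nat.cast_add, ← add_assoc]
      rfl
    · rw [← ht, window_center]

/-! ### Stable obstacles -/

/-- The state of a given kind, where `a` is the tile to be used. -/
def ofKind (k : Fin 4 × Fin 4) (a : T) : State T :=
  match k with
  | (1, 1) => .southeast
  | (1, 2) => .south
  | (1, 3) => .southwest
  | (2, 1) => .east
  | (2, 2) => .tile a
  | (2, 3) => .west
  | (3, 1) => .northeast
  | (3, 2) => .north
  | (3, 3) => .northwest
  | _ => .O

theorem kind_ofKind (a : T) (i j : Fin 4) : kind (ofKind (kindOf i j) a) = kindOf i j := by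
  fin_cases i <;> fin_cases j <;> rfl

theorem ofKind_eq_tile {a b : T} {i j : Fin 4} (h : ofKind (kindOf i j) a = .tile b) :
    i = 2 ∧ j = 2 ∧ a = b := by
  revert h
  fin_cases i <;> fin_cases j <;> simp [ofKind, kindOf]

/-- The class of `x` relative to the segment from `a` to `b`, which is `0` outside. -/
def extClass (a b x : ℤ) : Fin 4 := if a ≤ x ∧ x ≤ b then segClass a b x else 0

/-- An obstacle filled with the tiles `t`. -/
def obstacle (xl xr yb yt : ℤ) (t : ℤ → ℤ → T) : Config (State T) := fun p =>
  ofKind (kindOf (extClass (-yt) (-yb) (-p.2)) (extClass xl xr p.1)) (t p.1 p.2)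

theorem extClass_triple {a b : ℤ} (h : a + 3 ≤ b) (x : ℤ) :
    (extClass a b (x - 1), extClass a b x, extClass a b (x + 1)) ∈
      ([(0, 0, 0), (0, 0, 1), (0, 1, 2), (1, 2, 2), (2, 2, 2), (2, 2, 3), (2, 3, 0), (3, 0, 0)] :
        List (Fin 4 × Fin 4 × Fin 4)) := by
  have h0 : ∀ x, x < a ∨ b < x → extClass a b x = 0 := fun x hx => if_neg (by omega)
  have h1 : extClass a b a = 1 := by rw [extClass, if_pos (by omega), segClass_left]
  have h2 : ∀ x, a < x → x < b → extClass a b x = 2 := fun x _ _ => by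
    rw [extClass, if_pos (by omega), segClass_of_mem (by omega) (by omega)]
  have h3 : extClass a b b = 3 := by rw [extClass, if_pos (by omega), segClass_right (by omega)]
  rcases (show x + 1 < a ∨ x = a - 1 ∨ x = a ∨ x = a + 1 ∨ (a + 1 < x ∧ x < b - 1) ∨ x = b - 1 ∨
    x = b ∨ x = b + 1 ∨ b < x - 1 by omega) with
    k | rfl | rfl | rfl | ⟨k, k'⟩ | rfl | rfl | rfl | k
  · rw [h0 _ (by omega), h0 _ (by omega), h0 _ (by omega)]; decide
  · rw [h0 _ (by omega), h0 _ (by omega), sub_add_cancel, h1]; decide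
  · rw [h0 _ (by omega), h1, h2 _ (by omega) (by omega)]; decide
  · rw [add_sub_cancel_right, h1, h2 _ (by omega) (by omega), h2 _ (by omega) (by omega)]; decide
  · rw [h2 _ (by omega) (by omega), h2 _ (by omega) (by omega), h2 _ (by omega) (by omega)]; decide
  · rw [h2 _ (by omega) (by omega), h2 _ (by omega) (by omega), sub_add_cancel, h3]; decide
  · rw [h2 _ (by omega) (by omega), h3, h0 _ (by omega)]; decide
  · rw [add_sub_cancel_right, h3, h0 _ (by omega), h0 _ (by omega)]; decide
  · rw [h0 _ (by omega), h0 _ (by omega), h0 _ (by omega)]; decide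

theorem exists_colClass : ∀ k ∈ ([(0, 0, 0), (0, 0, 1), (0, 1, 2), (1, 2, 2), (2, 2, 2), (2, 2, 3),
      (2, 3, 0), (3, 0, 0)] : List (Fin 4 × Fin 4 × Fin 4)),
    ∃ c : Fin 8, colClass ⟨c + (0 : Fin 3), by omega⟩ = k.1 ∧
      colClass ⟨c + (1 : Fin 3), by omega⟩ = k.2.1 ∧
      colClass ⟨c + (2 : Fin 3), by omega⟩ = k.2.2 := by decide

/-- The picture has three liquid columns on the west but only two liquid rows on the north and on
the south, so three liquid rows do not occur as a row triple. A pattern with such a triple is liquid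
throughout and is found in the north-west block instead. -/
theorem exists_rowClass : ∀ k ∈ ([(0, 0, 0), (0, 0, 1), (0, 1, 2), (1, 2, 2), (2, 2, 2), (2, 2, 3),
      (2, 3, 0), (3, 0, 0)] : List (Fin 4 × Fin 4 × Fin 4)), k = (0, 0, 0) ∨
    ∃ r : Fin 7, rowClass ⟨r + (0 : Fin 3), by omega⟩ = k.1 ∧
      rowClass ⟨r + (1 : Fin 3), by omega⟩ = k.2.1 ∧
      rowClass ⟨r + (2 : Fin 3), by omega⟩ = k.2.2 := by decide

theorem kindOf_zero_left : ∀ b, kindOf 0 b = (0, 0) := by decide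

variable {xl xr yb yt : ℤ} {t : ℤ → ℤ → T}

theorem kind_obstacle (x y : ℤ) : kind (obstacle xl xr yb yt t (x, y)) =
    kindOf (extClass (-yt) (-yb) (-y)) (extClass xl xr x) := kind_ofKind _ _ _

theorem obstacle_eq_tile {x y : ℤ} {a : T} (h : obstacle xl xr yb yt t (x, y) = .tile a) :
    t x y = a ∧ xl < x ∧ x < xr ∧ yb < y ∧ y < yt := by
  obtain ⟨h1, h2, h3⟩ := ofKind_eq_tile h
  simp only [extClass, segClass] at h1 h2
  refine ⟨h3, ?_⟩
  split_ifs at h1 h2 with k1 k2 k3 k4 k5 k6 <;> omega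

theorem allowed_obstacle (hx : xl + 3 ≤ xr) (hy : yb + 3 ≤ yt)
    (hh : ∀ x y, xl < x → x + 1 < xr → yb < y → y < yt → τ.hor (t x y) (t (x + 1) y))
    (hv : ∀ x y, xl < x → x < xr → yb < y → y + 1 < yt → τ.ver (t x y) (t x (y + 1)))
    (x y : ℤ) : Allowed τ (window (obstacle xl xr yb yt t) x y) := by
  refine allowed_iff.2 ⟨?_, ?_, ?_⟩
  · obtain ⟨c, c0, c1, c2⟩ := exists_colClass _ (extClass_triple hx x)
    have hr := exists_rowClass _ (extClass_triple (show -yt + 3 ≤ -yb by omega) (-y))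
    rw [show -y - 1 = -(y + 1) by ring, show -y + 1 = -(y - 1) by ring] at hr
    rw [window_eq]
    rcases hr with hr | ⟨r, r0, r1, r2⟩
    · simp only [Prod.mk.injEq] at hr
      obtain ⟨r0, r1, r2⟩ := hr
      refine ⟨0, 0, fun i j => ?_⟩
      have : blockKind 0 0 i j = (0, 0) := by revert i j; decide
      rw [this]
      fin_cases i <;> fin_cases j <;> refine (kind_obstacle _ _).trans ?_ <;>
        simp only [r0, r1, r2, kindOf_zero_left]
    · refine ⟨r, c, fun i j => ?_⟩
      simp only at r0 r1 r2 c0 c1 c2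
      fin_cases i <;> fin_cases j <;> refine (kind_obstacle _ _).trans ?_ <;>
        simp only [blockKind, ← r0, ← r1, ← r2, ← c0, ← c1, ← c2] <;> rfl
  · intro i j j' hj a b ha hb
    obtain ⟨rfl, h1, h2, h3, h4⟩ := obstacle_eq_tile ha
    obtain ⟨rfl, h5, h6, h7, h8⟩ := obstacle_eq_tile hb
    have e : x + ((j' : ℕ) : ℤ) - 1 = x + ((j : ℕ) : ℤ) - 1 + 1 := by rw [hj]; push_cast; ring
    rw [e] at h6 ⊢
    exact hh _ _ h1 h6 h3 h4
  · intro i i' j hi a b ha hb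
    obtain ⟨rfl, h1, h2, h3, h4⟩ := obstacle_eq_tile ha
    obtain ⟨rfl, h5, h6, h7, h8⟩ := obstacle_eq_tile hb
    have e : y + 1 - ((i : ℕ) : ℤ) = y + 1 - ((i' : ℕ) : ℤ) + 1 := by rw [hi]; push_cast; ring
    rw [e] at h4 ⊢
    exact hv _ _ h1 h2 h7 h4

/-- An obstacle that is surrounded by liquid is stable. -/
theorem IsObstacle.iterate_eq {z v : Config (State T)} (hz : Admissible τ z)
    (ho : IsObstacle z xl xr yb yt)
    (hv : ∀ x y, xl - 2 ≤ x → x ≤ xr + 2 → yb - 2 ≤ y → y ≤ yt + 2 → v (x, y) = z (x, y)) (n : ℕ)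
    {x y : ℤ} (h1 : xl ≤ x) (h2 : x ≤ xr) (h3 : yb ≤ y) (h4 : y ≤ yt) :
    (tileCA τ)^[n] v (x, y) = z (x, y) := by
  -- The ring stays liquid because solid cells are never created. Its two layers contain everything
  -- outside the obstacle that the radius-2 rule sees from inside it.
  have ring : ∀ n x y, xl - 2 ≤ x → x ≤ xr + 2 → yb - 2 ≤ y → y ≤ yt + 2 →
      (x < xl ∨ xr < x ∨ y < yb ∨ yt < y) → (tileCA τ)^[n] v (x, y) ∉ TileCA.solid T := by
    intro n x y h1 h2 h3 h4 h5 h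
    have := (solid_of_iterate_solid h).1
    rw [hv x y h1 h2 h3 h4] at this
    exact ho.notMem_solid h1 h2 h3 h4 h5 this
  induction n generalizing x y with
  | zero => exact hv x y (by omega) (by omega) (by omega) (by omega)
  | succ n ih =>
    have e := ih h1 h2 h3 h4
    rw [Function.iterate_succ_apply', tileCA_of_solid _ (e ▸ ho.solid h1 h2 h3 h4), e]
    intro x' y' hx hy
    rw [abs_le] at hx hy
    refine (hz x' y').congr fun i j => ?_
    have hcell : ∀ x y, xl - 2 ≤ x → x ≤ xr + 2 → yb - 2 ≤ y → y ≤ yt + 2 →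
        (tileCA τ)^[n] v (x, y) = z (x, y) ∨
        (tileCA τ)^[n] v (x, y) ∈ liquid T ∧ z (x, y) ∈ liquid T := by
      intro x y k1 k2 k3 k4
      by_cases k5 : x < xl ∨ xr < x ∨ y < yb ∨ yt < y
      · exact .inr ⟨notMem_solid_iff.1 (ring n x y k1 k2 k3 k4 k5),
          notMem_solid_iff.1 (ho.notMem_solid k1 k2 k3 k4 k5)⟩
      · exact .inl (ih (by omega) (by omega) (by omega) (by omega))
    have := i.2
    have := j.2
    exact hcell _ _ (by omega) (by omega) (by omega) (by omega)

theorem isObstacle_obstacle (hz : Admissible τ (obstacle xl xr yb yt t)) (hx : xl < xr)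
    (hy : yb < yt) : IsObstacle (obstacle xl xr yb yt t) xl xr yb yt := by
  refine hz.isObstacle hx hy fun x y h1 h2 h3 h4 => ?_
  rw [kind_obstacle, extClass, extClass, if_pos (by omega), if_pos (by omega), kindOf, if_neg]
  · simp only [segClass, neg_inj]
  · simp [segClass_ne_zero]

end TileCA

/-! ### Absence of equicontinuous points and the exact sensitivity constant. -/

namespace TileCA
variable {T : Type u} {τ : TileSet T}

/-! ### Instability -/

/-- `x` on the ball of radius less than `r`, and `O` elsewhere. -/
def cut (x : Config (State T)) (r : ℕ) : Config (State T) :=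
  fun p => if supNorm p < r then x p else .O

theorem supNorm_lt_iff {p : ℤ × ℤ} {k : ℕ} : supNorm p < k ↔ |p.1| < k ∧ |p.2| < k := by
  rw [supNorm, Int.abs_eq_natAbs, Int.abs_eq_natAbs]
  omega

theorem cut_of_lt (x : Config (State T)) {r : ℕ} {p : ℤ × ℤ} (h : supNorm p < r) :
    cut x r p = x p := if_pos h

theorem cut_bound (x : Config (State T)) (r : ℕ) (a b : ℤ) (h : cut x r (a, b) ≠ .O) :
    |a| ≤ (r : ℤ) ∧ |b| ≤ (r : ℤ) := by
  unfold cut at h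
  split_ifs at h with h1
  · obtain ⟨h1, h2⟩ := supNorm_lt_iff.1 h1
    exact ⟨h1.le, h2.le⟩
  · exact absurd rfl h

theorem cut_of_solid {x : Config (State T)} {r : ℕ} {p : ℤ × ℤ}
    (h : limitConfig τ (cut x r) p ∈ solid T) : limitConfig τ (cut x r) p = x p := by
  have e : cut x r p = _ := limitConfig_of_solid h 0
  rw [← e] at h ⊢
  unfold cut at h ⊢
  split_ifs at h ⊢
  · rfl
  · exact absurd h O_notMem_solid

/-- If a cell is liquid in the limit of a part of `x`, then a change of `x` outside this part is
seen in this cell. -/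
theorem exists_iterate_ne_of_cut {x : Config (State T)} {r : ℕ} {p : ℤ × ℤ}
    (h : limitConfig τ (cut x r) p ∉ solid T) :
    ∃ y t, (∀ q, supNorm q < r → x q = y q) ∧ (tileCA τ)^[t] x p ≠ (tileCA τ)^[t] y p := by
  obtain ⟨v', t, hv', hne⟩ := exists_iterate_ne (x := p.1) (y := p.2) (cut_bound x r) h
  -- The orbits of `cut x r` and `v'` differ at `p`, so that of `x` differs from one of them, and
  -- both start equal to `x` on the ball.
  by_cases hx : (tileCA τ)^[t] x p = (tileCA τ)^[t] (cut x r) p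
  · refine ⟨v', t, fun q hq => ?_, hx ▸ hne⟩
    have hq' := supNorm_lt_iff.1 hq
    rw [← cut_of_lt x hq]
    exact (hv' q.1 q.2 (by have := abs_le.1 hq'.1.le; omega)).symm
  · exact ⟨cut x r, t, fun q hq => (cut_of_lt x hq).symm, hx⟩

theorem half_pow_le_dist {A : Type u} {x y : Config A} {p : ℤ × ℤ} (h : x p ≠ y p) :
    (1 / 2 : ℝ) ^ supNorm p ≤ dist x y := by
  change _ ≤ configDist x y
  unfold configDist
  split_ifs with e
  · exact absurd (congrFun e p) h
  exact pow_le_pow_of_le_one (by norm_num) (by norm_num) (Nat.sInf_le ⟨p, rfl, h⟩)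

theorem dist_le_half_pow_iff {A : Type u} {x y : Config A} {k : ℕ} :
    dist x y ≤ (1 / 2 : ℝ) ^ k ↔ ∀ z, supNorm z < k → x z = y z :=
  configDist_le_iff x y k

theorem blockKind_of_solid : ∀ r c, (∀ i j, blockKind r c i j ≠ (0, 0)) →
    blockKind r c 1 1 = (2, 2) := by decide

/-- Some cell is liquid in the limits of all large parts of `x`. -/
theorem exists_forall_limitConfig_cut (x : Config (State T)) :
    ∃ p r₀, ∀ r, r₀ ≤ r → limitConfig τ (cut x r) p ∉ solid T := by
  -- If everything stays solid forever, `x` consists of tiles only, so a cut contains no arrows and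
  -- no obstacle can survive in it. Otherwise some cell becomes liquid at a finite time, and this
  -- depends only on a finite part of `x`.
  by_cases h : ∀ t p, (tileCA τ)^[t] x p ∈ solid T
  · have hx : Admissible τ x := fun a b => (of_tileCA_solid (h 1 (a, b))).1 a b (by simp) (by simp)
    have hk : ∀ a b, kind (x (a, b)) = (2, 2) := by
      intro a b
      obtain ⟨⟨r, c, hrc⟩, -⟩ := allowed_iff.1 (hx a b)
      rw [← window_center x, hrc]
      exact blockKind_of_solid r c fun i j => by
        rw [← hrc, ← mem_solid_iff]
        exact h 0 _
    refine ⟨(0, 0), 0, fun r _ hs => ?_⟩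
    have hz := admissible_limitConfig (τ := τ) (cut_bound x r)
    obtain ⟨xl, xr, yb, yt, ho, h1, h2, h3, h4⟩ := hz.exists_isObstacle (B := r) (fun a b hab =>
      cut_bound x r a b fun h' => by
        have e : cut x r (a, b) = _ := limitConfig_of_solid hab 0
        rw [← e, h'] at hab
        exact O_notMem_solid hab) hs
    have e := ho.kind_eq xl yb le_rfl (by omega) le_rfl (by omega)
    rw [cut_of_solid (ho.solid le_rfl (by omega) le_rfl (by omega)), hk, segClass_left] at e
    exact absurd (show (2 : Fin 4) = 1 from congrArg Prod.snd e) (by decide)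
  · push Not at h
    obtain ⟨t, p, h⟩ := h
    -- The rule has radius 2, so `t` steps at `p` depend only on cells within distance `2 * t`.
    refine ⟨p, supNorm p + 2 * t + 1, fun r hr => limitConfig_notMem_solid (t := t) ?_⟩
    have e : (tileCA τ)^[t] (cut x r) (p.1, p.2) = (tileCA τ)^[t] x (p.1, p.2) :=
      iterate_tileCA_congr t fun a b ha hb => cut_of_lt x (supNorm_lt_iff.2 (by
        have h1 := supNorm_lt_iff.1 (Nat.lt_succ_self (supNorm p))
        simp only [abs_le, abs_lt] at *
        push_cast at *
        omega))
    rw [show p = (p.1, p.2) from rfl] at h ⊢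
    rwa [e]

theorem not_isEquicontinuousPoint (x : Config (State T)) :
    ¬ IsEquicontinuousPoint (tileCA τ) x := by
  intro h
  obtain ⟨p, r₀, hp⟩ := exists_forall_limitConfig_cut (τ := τ) x
  obtain ⟨δ, hδ, h⟩ := h ((1 / 2) ^ supNorm p) (by positivity)
  obtain ⟨k, hk⟩ := exists_pow_lt_of_lt_one hδ (show (1 / 2 : ℝ) < 1 by norm_num)
  obtain ⟨y, t, hy, hne⟩ := exists_iterate_ne_of_cut (hp (max r₀ k) (le_max_left _ _))
  have h1 : dist x y ≤ (1 / 2) ^ k :=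
    dist_le_half_pow_iff.2 fun z hz => hy z (hz.trans_le (le_max_right _ _))
  exact absurd (h y (h1.trans_lt hk) t) (not_lt.2 (half_pow_le_dist hne))

/-! ### Sensitivity constants -/

/-- If `n` is the size of the largest square that can be tiled, the sensitivity constants are the
positive numbers below `2 ^ (- sensitivityExponent n)`. -/
def sensitivityExponent (n : ℕ) : ℕ := if n < 2 then 0 else (n + 1) / 2 + 1

/-- A limit has a liquid cell near the origin if large squares cannot be tiled. -/
theorem exists_limitConfig_notMem_solid {n : ℕ} (hn : ∀ k, τ.TilesSquare k → k ≤ n)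
    (x : Config (State T)) (r : ℕ) :
    ∃ p, supNorm p ≤ sensitivityExponent n ∧ limitConfig τ (cut x r) p ∉ solid T := by
  by_contra! h
  obtain ⟨k, hk⟩ : ∃ k, k = sensitivityExponent n := ⟨_, rfl⟩
  have hs : ∀ a b : ℤ, |a| ≤ k → |b| ≤ k → limitConfig τ (cut x r) (a, b) ∈ solid T :=
    fun a b ha hb => h (a, b) (by
      rw [← hk, ← Nat.lt_succ_iff, supNorm_lt_iff]
      push_cast
      exact ⟨Int.lt_add_one_iff.2 ha, Int.lt_add_one_iff.2 hb⟩)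
  have hz := admissible_limitConfig (τ := τ) (cut_bound x r)
  obtain ⟨xl, xr, yb, yt, ho, h1, h2, h3, h4⟩ := hz.exists_isObstacle (B := r) (fun a b hab =>
    cut_bound x r a b fun h' => by
      have e : cut x r (a, b) = _ := limitConfig_of_solid hab 0
      rw [← e, h'] at hab
      exact O_notMem_solid hab) (hs 0 0 (by simp) (by simp))
  have hw := ho.width
  have hh := ho.height
  -- If a side of the obstacle lay inside the ball, a cell of its liquid ring would be in the ball
  -- too.
  have k1 : k ≤ xr := by
    by_contra hlt
    exact ho.notMem_solid (x := xr + 1) (y := 0) (by omega) (by omega) (by omega) (by omega)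
      (by omega) (hs _ _ (abs_le.2 (by omega)) (by simp))
  have k2 : xl ≤ -k := by
    by_contra hlt
    exact ho.notMem_solid (x := xl - 1) (y := 0) (by omega) (by omega) (by omega) (by omega)
      (by omega) (hs _ _ (abs_le.2 (by omega)) (by simp))
  have k3 : k ≤ yt := by
    by_contra hlt
    exact ho.notMem_solid (x := 0) (y := yt + 1) (by omega) (by omega) (by omega) (by omega)
      (by omega) (hs _ _ (by simp) (abs_le.2 (by omega)))
  have k4 : yb ≤ -k := by
    by_contra hlt
    exact ho.notMem_solid (x := 0) (y := yb - 1) (by omega) (by omega) (by omega) (by omega)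
      (by omega) (hs _ _ (by simp) (abs_le.2 (by omega)))
  unfold sensitivityExponent at hk
  split_ifs at hk with hn2
  · have := hn _ (ho.tilesSquare hz (n := 2) (by push_cast; omega) (by push_cast; omega))
    omega
  -- The obstacle spans `-k..k` in both directions. Removing the frame leaves side `2 * k - 1`,
  -- which exceeds `n` for either parity.
  · have := hn _ (ho.tilesSquare hz (n := 2 * k - 1) (by omega) (by omega))
    omega

theorem isSensitivityConstant_of_lt {n : ℕ} (hn : ∀ k, τ.TilesSquare k → k ≤ n) {ε : ℝ}
    (hε : 0 < ε) (h : ε < (1 / 2) ^ sensitivityExponent n) :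
    IsSensitivityConstant (tileCA τ) ε := by
  refine ⟨hε, fun δ hδ x => ?_⟩
  obtain ⟨r, hr⟩ := exists_pow_lt_of_lt_one hδ (show (1 / 2 : ℝ) < 1 by norm_num)
  obtain ⟨p, hp, hps⟩ := exists_limitConfig_notMem_solid hn x r
  obtain ⟨y, t, hy, hne⟩ := exists_iterate_ne_of_cut hps
  refine ⟨y, t, (dist_le_half_pow_iff.2 hy).trans_lt hr, h.trans_le ?_⟩
  exact (pow_le_pow_of_le_one (by norm_num) (by norm_num) hp).trans (half_pow_le_dist hne)

theorem IsSensitivityConstant.lt {n : ℕ} (hn : τ.TilesSquare n) {ε : ℝ}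
    (h : IsSensitivityConstant (tileCA τ) ε) : ε < (1 / 2) ^ sensitivityExponent n := by
  obtain ⟨-, h⟩ := h
  by_cases hn2 : n < 2
  · obtain ⟨y, t, -, h⟩ := h 1 one_pos fun _ => .O
    refine h.trans_le (dist_le_half_pow_iff.2 fun z hz => ?_)
    rw [sensitivityExponent, if_pos hn2] at hz
    omega
  obtain ⟨s, hs1, hs2⟩ := hn.exists_int (by omega)
  -- The framed square has side `n + 2` and is placed on `-k..n + 1 - k`. It then contains every
  -- cell of norm at most `k`, where `k + 1` is the sensitivity exponent.
  obtain ⟨k, hk⟩ : ∃ k, k = (n + 1) / 2 := ⟨_, rfl⟩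
  have hadm : Admissible τ (obstacle (-k) (n + 1 - k) (-k) (n + 1 - k)
      fun x y => s (x + k - 1) (y + k - 1)) :=
    allowed_obstacle (by omega) (by omega)
      (fun x y h1 h2 h3 h4 => by
        have := hs1 (x + k - 1) (y + k - 1) (by omega) (by omega) (by omega) (by omega)
        rwa [show x + k - 1 + 1 = x + 1 + k - 1 by ring] at this)
      (fun x y h1 h2 h3 h4 => by
        have := hs2 (x + k - 1) (y + k - 1) (by omega) (by omega) (by omega) (by omega)
        rwa [show y + k - 1 + 1 = y + 1 + k - 1 by ring] at this)
  have ho := isObstacle_obstacle hadm (by omega) (by omega)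
  set z := obstacle (-k) (n + 1 - k) (-k) (n + 1 - k) fun x y => s (x + k - 1) (y + k - 1)
  -- A radius large enough for the obstacle and its liquid ring, so that the obstacle is stable in
  -- every such `y`.
  obtain ⟨y, t, hy, h⟩ := h ((1 / 2) ^ (n + 4)) (by positivity) z
  refine h.trans_le (dist_le_half_pow_iff.2 fun q hq => ?_)
  rw [sensitivityExponent, if_neg hn2, supNorm_lt_iff, abs_lt, abs_lt, ← hk] at hq
  push_cast at hq
  have hstab := fun (v : Config (State T)) (hv : ∀ a b : ℤ, |a| < n + 4 → |b| < n + 4 →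
      v (a, b) = z (a, b)) => ho.iterate_eq hadm (v := v) (fun a b h1 h2 h3 h4 =>
        hv a b (abs_lt.2 (by omega)) (abs_lt.2 (by omega))) t (x := q.1) (y := q.2)
        (by omega) (by omega) (by omega) (by omega)
  refine (hstab z fun _ _ _ _ => rfl).trans (hstab y fun a b ha hb => ?_).symm
  exact (dist_le_half_pow_iff.1 hy.le (a, b)
    (supNorm_lt_iff.2 ⟨by push_cast; exact ha, by push_cast; exact hb⟩)).symm

theorem isSensitive_iff [Finite T] : IsSensitive (tileCA τ) ↔ ¬ τ.TilesPlane := by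
  constructor
  · rintro ⟨ε, h⟩ hp
    obtain ⟨k, hk⟩ := exists_pow_lt_of_lt_one h.1 (show (1 / 2 : ℝ) < 1 by norm_num)
    refine absurd (IsSensitivityConstant.lt (hp.tilesSquare (2 * k + 2)) h)
      (not_lt.2 (le_trans ?_ hk.le))
    refine pow_le_pow_of_le_one (by norm_num) (by norm_num) ?_
    rw [sensitivityExponent, if_neg (by omega)]
    omega
  · intro h
    obtain ⟨n, hn⟩ := exists_isGreatest_tilesSquare h
    exact ⟨(1 / 2) ^ sensitivityExponent n / 2,
      isSensitivityConstant_of_lt (fun k hk => hn.2 hk) (by positivity)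
        (half_lt_self (by positivity))⟩

theorem isLUB_sensitivityConstant {n : ℕ} (hn : IsGreatest {k : ℕ | τ.TilesSquare k} n) :
    IsLUB {ε : ℝ | IsSensitivityConstant (tileCA τ) ε} ((1 / 2) ^ sensitivityExponent n) := by
  refine ⟨fun ε hε => (IsSensitivityConstant.lt hn.1 hε).le, fun b hb => ?_⟩
  refine le_of_forall_lt_imp_le_of_dense fun ε hε => ?_
  rcases le_or_gt ε 0 with h0 | h0
  · have hp : (0 : ℝ) < (1 / 2) ^ sensitivityExponent n := by positivity
    have := hb (isSensitivityConstant_of_lt (fun k hk => hn.2 hk) (half_pos hp) (half_lt_self hp))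
    linarith
  · exact hb (isSensitivityConstant_of_lt (fun k hk => hn.2 hk) h0 hε)

/-- The exponent differs from `n / 2` by at most 2 upwards and by at most `1 / 2` downwards. -/
theorem half_pow_sensitivityExponent_bounds (n : ℕ) :
    1 / 4 * (2 : ℝ) ^ (-(n : ℝ) / 2) ≤ (1 / 2) ^ sensitivityExponent n ∧
      (1 / 2) ^ sensitivityExponent n ≤ 2 * (2 : ℝ) ^ (-(n : ℝ) / 2) := by
  have h1 : (n : ℝ) ≤ 2 * sensitivityExponent n + 1 := by
    unfold sensitivityExponent
    split_ifs <;> norm_cast <;> omega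
  have h2 : (2 * sensitivityExponent n : ℝ) ≤ n + 4 := by
    unfold sensitivityExponent
    split_ifs <;> norm_cast <;> omega
  have e : ((1 / 2 : ℝ)) ^ sensitivityExponent n = (2 : ℝ) ^ (-(sensitivityExponent n : ℝ)) := by
    rw [Real.rpow_neg (by norm_num), Real.rpow_natCast, one_div, inv_pow]
  have e4 : (1 / 4 : ℝ) = (2 : ℝ) ^ (-2 : ℝ) := by
    rw [Real.rpow_neg (by norm_num)]
    norm_num
  rw [e, e4, ← Real.rpow_add (by norm_num)]
  constructor
  · exact Real.rpow_le_rpow_of_exponent_le (by norm_num) (by linarith)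
  · calc (2 : ℝ) ^ (-(sensitivityExponent n : ℝ)) ≤ (2 : ℝ) ^ (1 + -(n : ℝ) / 2) :=
          Real.rpow_le_rpow_of_exponent_le (by norm_num) (by linarith)
      _ = 2 * (2 : ℝ) ^ (-(n : ℝ) / 2) := by rw [Real.rpow_add (by norm_num), Real.rpow_one]

end TileCA

theorem mainTheorem8 :
    ∃ g : ℕ → ℝ,
      (∃ c C : ℝ, 0 < c ∧ 0 < C ∧ ∀ n : ℕ,
        c * (2 : ℝ) ^ (-(n : ℝ) / 2) ≤ g n ∧ g n ≤ C * (2 : ℝ) ^ (-(n : ℝ) / 2)) ∧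
      ∀ (T : Type u) [Finite T] (τ : TileCA.TileSet T),
        (∀ x, ¬ TileCA.IsEquicontinuousPoint (TileCA.tileCA τ) x) ∧
        (TileCA.IsSensitive (TileCA.tileCA τ) ↔ ¬ τ.TilesPlane) ∧
        (TileCA.IsSensitive (TileCA.tileCA τ) →
          ∃ n : ℕ, IsGreatest {k : ℕ | τ.TilesSquare k} n ∧
            IsLUB {ε : ℝ | TileCA.IsSensitivityConstant (TileCA.tileCA τ) ε} (g n)) := by
  refine ⟨fun n => (1 / 2) ^ TileCA.sensitivityExponent n, ⟨1 / 4, 2, by norm_num, by norm_num,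
    TileCA.half_pow_sensitivityExponent_bounds⟩, fun T _ τ =>
    ⟨TileCA.not_isEquicontinuousPoint, TileCA.isSensitive_iff, fun h => ?_⟩⟩
  obtain ⟨n, hn⟩ := TileCA.exists_isGreatest_tilesSquare (TileCA.isSensitive_iff.1 h)
  exact ⟨n, hn, TileCA.isLUB_sensitivityConstant hn⟩
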